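/- **Setting.** Let $U\subseteq\mathbb R^d$ be open and connected, let $\Gamma^a_{bc}=\Gamma^a_{cb}$ and $Q^a$ be smooth on $U$ ($\Gamma$ need not come from a metric), and consider the autonomous system $$\ddot q^a=-\Gamma^a_{bc}(q)\dot q^b\dot q^c-Q^a(q).\qquad(\ast)$$ A function $I(t,q,\dot q)$ is a first integral (FI) if $dI/dt=0$ along every solution of $(\ast)$ in $U$. A comma denotes partial and a bar covariant differentiation with respect to $\Gamma$, and round brackets denote (normalized) symmetrization. All tensors are smooth on $U$. A totally symmetric tensor $T_{i_1\dots i_r}$ is a generalized Killing tensor (KT) of order $r$ if $T_{(i_1\dots i_r|i_{r+1})}=0$. Let $m\ge 2$. An $m$-th order FI is a FI of the form $I=M(t,q)+\sum_{r=1}^{m}M_{i_1\dots i_r}(t,q)\dot q^{i_1}\cdots\dot q^{i_r}$ with totally symmetric coefficients, smooth in $(t,q)$ (the coefficient of highest rank may vanish). **Type $I_n^{(m)}$** ($n\ge0$). $$I_n^{(m)}=\Big(-\sum_{N=1}^{n}\tfrac{t^N}{N}L_{(N-1)(i_1\dots i_{m-1}|i_m)}+C_{(0)i_1\dots i_m}\Big)\dot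 q^{i_1}\cdots\dot q^{i_m}+\sum_{r=1}^{m-1}\Big(\sum_{N=0}^{n}t^NL_{(N)i_1\dots i_r}\Big)\dot q^{i_1}\cdots\dot q^{i_r}+s\tfrac{t^{n+1}}{n+1}+\sum_{N=1}^{n}L_{(N-1)c}Q^c\tfrac{t^N}{N}+G(q),$$ where the $L_{(N)i_1\dots i_r}$ ($0\le N\le n$, $1\le r\le m-1$) are totally symmetric, $C_{(0)i_1\dots i_m}$ and $L_{(N)(i_1\dots i_{m-1}|i_m)}$ ($0\le N\le n-1$) are KTs of order $m$, $L_{(n)i_1\dots i_{m-1}}$ is a KT of order $m-1$, $s$ is a constant with $L_{(n)i}Q^i=s$, and - if $m\ge3$: $L_{(n)(i_1\dots i_{m-2}|i_{m-1})}=-\frac mn L_{(n-1)(i_1\dots i_{m-1}|i_m)}Q^{i_m}$ (if $n\ge1$); $L_{(k-1)(i_1\dots i_{m-2}|i_{m-1})}=-\frac m{k-1}L_{(k-2)(i_1\dots i_{m-1}|i_m)}Q^{i_m}-kL_{(k)i_1\dots i_{m-1}}$ for $2\le k\le n$; $L_{(0)(i_1\dots i_{m-2}|i_{m-1})}=mC_{(0)i_1\dots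 i_m}Q^{i_m}-L_{(1)i_1\dots i_{m-1}}$; - for $2\le r\le m-2$: $L_{(n)(i_1\dots i_{r-1}|i_r)}=(r+1)L_{(n)i_1\dots i_{r+1}}Q^{i_{r+1}}$, and $L_{(k-1)(i_1\dots i_{r-1}|i_r)}=(r+1)L_{(k-1)i_1\dots i_{r+1}}Q^{i_{r+1}}-kL_{(k)i_1\dots i_r}$ for $1\le k\le n$; - $(L_{(n-1)c}Q^c)_{,i}=2nL_{(n)ij}Q^j$ (if $n\ge1$); $(L_{(k-2)c}Q^c)_{,i}=2(k-1)L_{(k-1)ij}Q^j-k(k-1)L_{(k)i}$ for $2\le k\le n$; $G_{,i}=2L_{(0)ij}Q^j-L_{(1)i}$. Here $L_{(1)\cdots}:=0$ if $n=0$; and if $m=2$, then in the last item $L_{(0)ij}:=C_{(0)ij}$ and $L_{(N)ij}:=-\frac1NL_{(N-1)(i|j)}$ for $N\ge1$. **Type $I_e^{(m)}$** (with constant $\lambda\in\mathbb R$, $\lambda\ne0$). $$I_e^{(m)}=\frac{e^{\lambda t}}{\lambda}\Big(-L_{(i_1\dots i_{m-1}|i_m)}\dot q^{i_1}\cdots\dot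 q^{i_m}+\lambda\sum_{r=1}^{m-1}L_{i_1\dots i_r}\dot q^{i_1}\cdots\dot q^{i_r}+L_iQ^i\Big),$$ where the $L_{i_1\dots i_r}$ ($1\le r\le m-1$) are totally symmetric, $L_{(i_1\dots i_{m-1}|i_m)}$ is a KT of order $m$, and - if $m\ge3$: $L_{(i_1\dots i_{m-2}|i_{m-1})}=-\frac m\lambda L_{(i_1\dots i_{m-1}|i_m)}Q^{i_m}-\lambda L_{i_1\dots i_{m-1}}$; - for $2\le r\le m-2$: $L_{(i_1\dots i_{r-1}|i_r)}=(r+1)L_{i_1\dots i_{r+1}}Q^{i_{r+1}}-\lambda L_{i_1\dots i_r}$; - $(L_cQ^c)_{,i}=2\lambda L_{ij}Q^j-\lambda^2L_i$, where $L_{ij}:=-\frac1\lambda L_{(i|j)}$ if $m=2$. **Theorem.** Every function of type $I_n^{(m)}$ and every function of type $I_e^{(m)}$ is a FI of $(\ast)$. Conversely: 1. an $m$-th order FI whose coefficients of rank $r=1,\dots,m$ are polynomials in $t$ of degree at most $n$ (with coefficients depending on $q$) is of type $I_n^{(m)}$; 2. an $m$-th order FI all of whose coefficients (rank $0$ included)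 are $e^{\lambda t}$, $\lambda\neq0$, times functions of $q$ is of type $I_e^{(m)}$ with this $\lambda$; 3. an $m$-th order FI whose coefficients of rank $r=1,\dots,m$ are sums of a polynomial in $t$ of degree at most $n$ and of finitely many terms $e^{\lambda t}B_{(\lambda)i_1\dots i_r}(q)$, with $\lambda$ in a finite set $S$ of nonzero reals, is the sum of one FI of type $I_n^{(m)}$ and of one FI of type $I_e^{(m)}$ for each $\lambda\in S$. Thus the independent FIs of this class are those of the two types. -/

import Mathlib

open Set

namespace FirstIntegrals

noncomputable section

/-- Coordinate space `ℝ^d` (positions `q` and velocities `v`). -/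
abbrev Coord (d : ℕ) : Type := Fin d → ℝ

/-- A covariant tensor field of rank `r` through its components `T_{i₁…i_r}(q)`. -/
abbrev Field (d r : ℕ) : Type := Coord d → (Fin r → Fin d) → ℝ

/-- Connection coefficients: `Γ q a b c` is `Γ^a_{bc}(q)`. -/
abbrev Conn (d : ℕ) : Type := Coord d → Fin d → Fin d → Fin d → ℝ

/-- Right-hand side `-Γ^a_{bc}(q) v^b v^c - Q^a(q)` of the dynamical equations. -/
def accel {d : ℕ} (Γ : Conn d) (Q : Coord d → Coord d) (q v : Coord d) : Coord d :=
  fun a => -(∑ b, ∑ c, Γ q a b c * v b * v c) - Q q a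

/-- `q`, with velocity `v`, solves `q̈^a = -Γ^a_{bc} q̇^b q̇^c - Q^a` in `U` on the open
time interval `(t₀, t₁)`. -/
def IsSolution {d : ℕ} (U : Set (Coord d)) (Γ : Conn d) (Q : Coord d → Coord d)
    (t₀ t₁ : ℝ) (q v : ℝ → Coord d) : Prop :=
  ∀ t ∈ Ioo t₀ t₁, q t ∈ U ∧ HasDerivAt q (v t) t ∧
    HasDerivAt v (accel Γ Q (q t) (v t)) t

/-- `I(t, q, q̇)` is a first integral: `dI/dt = 0` along every solution. -/
def IsFirstIntegral {d : ℕ} (U : Set (Coord d)) (Γ : Conn d) (Q : Coord d → Coord d)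
    (I : ℝ → Coord d → Coord d → ℝ) : Prop :=
  ∀ (t₀ t₁ : ℝ) (q v : ℝ → Coord d), IsSolution U Γ Q t₀ t₁ q v →
    ∀ t ∈ Ioo t₀ t₁, HasDerivAt (fun τ => I τ (q τ) (v τ)) 0 t

/-- Partial derivative `f_{,k}`. -/
def pderiv {d : ℕ} (f : Coord d → ℝ) (q : Coord d) (k : Fin d) : ℝ :=
  fderiv ℝ f q (Pi.single k 1)

/-- Covariant derivative
`T_{i₁…i_r|k} = T_{i₁…i_r,k} - ∑_j Γ^c_{i_j k} T_{i₁…c…i_r}`, with `c` in the `j`-th place. -/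
def covDeriv {d r : ℕ} (Γ : Conn d) (T : Field d r) (q : Coord d)
    (i : Fin r → Fin d) (k : Fin d) : ℝ :=
  pderiv (fun x => T x i) q k
    - ∑ j : Fin r, ∑ c : Fin d, Γ q c (i j) k * T q (Function.update i j c)

/-- Symmetrized covariant derivative `T_{(i₁…i_r|i_{r+1})}`. -/
def symCov {d r : ℕ} (Γ : Conn d) (T : Field d r) : Field d (r + 1) :=
  fun q i => ((r + 1).factorial : ℝ)⁻¹ * ∑ σ : Equiv.Perm (Fin (r + 1)),
    covDeriv Γ T q (fun j => i (σ j.castSucc)) (i (σ (Fin.last r)))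

/-- Contraction `T_{i₁…i_r c} Q^c`. -/
def contr {d r : ℕ} (T : Field d (r + 1)) (Q : Coord d → Coord d) : Field d r :=
  fun q i => ∑ c, T q (Fin.snoc (α := fun _ => Fin d) i c) * Q q c

/-- The scalar `L_c Q^c` of a covector field `L`. -/
def pairing {d : ℕ} (L : Field d 1) (Q : Coord d → Coord d) (q : Coord d) : ℝ :=
  ∑ c, L q (fun _ => c) * Q q c

/-- `T_{i₁…i_r} v^{i₁} … v^{i_r}`. -/
def evalVel {d r : ℕ} (T : (Fin r → Fin d) → ℝ) (v : Coord d) : ℝ :=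
  ∑ i : Fin r → Fin d, T i * ∏ j, v (i j)

/-- A smooth, totally symmetric tensor field on `U`. -/
def IsSymmTensor {d r : ℕ} (U : Set (Coord d)) (T : Field d r) : Prop :=
  ContDiffOn ℝ (⊤ : ℕ∞) T U ∧
    ∀ q ∈ U, ∀ (σ : Equiv.Perm (Fin r)) (i : Fin r → Fin d), T q (i ∘ σ) = T q i

/-- A generalized Killing tensor of order `r`: `T` totally symmetric, `T_{(i₁…i_r|i_{r+1})} = 0`. -/
def IsKilling {d r : ℕ} (U : Set (Coord d)) (Γ : Conn d) (T : Field d r) : Prop :=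
  IsSymmTensor U T ∧ ∀ q ∈ U, ∀ i, symCov Γ T q i = 0

/-! The order of the first integrals is written `m = p + 2`. A family `L` of tensors has
`L N r = L_{(N) i₁…i_r}`; only `1 ≤ r ≤ m - 1` matters. -/

/-- The rank-`m` coefficient of `t^N`: `C_{(0)}` if `N = 0`, and
`-(1/N) L_{(N-1)(i₁…i_{m-1}|i_m)}` if `N ≥ 1`. -/
def topCoeff {d p : ℕ} (Γ : Conn d) (C : Field d (p + 2)) (L : ℕ → (r : ℕ) → Field d r)
    (N : ℕ) : Field d (p + 2) :=
  fun q i => if N = 0 then C q i else -(1 / (N : ℝ)) * symCov Γ (L (N - 1) (p + 1)) q i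

/-- `L_{(N) i₁ i₂}`, the rank-two coefficient of `t^N`. If `m = 2` this is the coefficient of
highest rank; if `m ≥ 3` it is a member of the family `L`. -/
def rankTwo {d : ℕ} (Γ : Conn d) : (p : ℕ) → Field d (p + 2) → (ℕ → (r : ℕ) → Field d r) →
    ℕ → Field d 2
  | 0, C, L, N => topCoeff Γ C L N
  | _ + 1, _, L, N => L N 2

/-- The function `I_n^{(m)}`. -/
def integralPoly {d p : ℕ} (Γ : Conn d) (Q : Coord d → Coord d) (n : ℕ)
    (C : Field d (p + 2)) (L : ℕ → (r : ℕ) → Field d r) (s : ℝ) (G : Coord d → ℝ) :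
    ℝ → Coord d → Coord d → ℝ :=
  fun t q v =>
    evalVel (fun i => -(∑ N ∈ Finset.Icc 1 n, t ^ N / N * symCov Γ (L (N - 1) (p + 1)) q i)
      + C q i) v
    + ∑ r ∈ Finset.Icc 1 (p + 1),
        evalVel (fun i => ∑ N ∈ Finset.range (n + 1), t ^ N * L N r q i) v
    + s * (t ^ (n + 1) / ((n : ℝ) + 1))
    + ∑ N ∈ Finset.Icc 1 n, pairing (L (N - 1) 1) Q q * (t ^ N / N)
    + G q

/-- The conditions on the data `C_{(0)}, L_{(N)}, s, G` of `I_n^{(m)}`, `m = p + 2`. The sequence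
`L_{(0)}, …, L_{(n)}` is continued by `0`. -/
structure IsPolyData {d p : ℕ} (U : Set (Coord d)) (Γ : Conn d) (Q : Coord d → Coord d)
    (n : ℕ) (C : Field d (p + 2)) (L : ℕ → (r : ℕ) → Field d r) (s : ℝ)
    (G : Coord d → ℝ) : Prop where
  L_beyond : ∀ N r, n < N → L N r = 0
  L_symm : ∀ N r, N ≤ n → 1 ≤ r → r ≤ p + 1 → IsSymmTensor U (L N r)
  G_smooth : ContDiffOn ℝ (⊤ : ℕ∞) G U
  C_killing : IsKilling U Γ C
  L_killing : ∀ N, N < n → IsKilling U Γ (symCov Γ (L N (p + 1)))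
  L_last_killing : IsKilling U Γ (L n (p + 1))
  s_eq : ∀ q ∈ U, pairing (L n 1) Q q = s
  /- Rank `m - 1`, for `m ≥ 3`. -/
  cond_a : 1 ≤ p → 1 ≤ n → ∀ q ∈ U, ∀ i : Fin (p + 1) → Fin d,
    symCov Γ (L n p) q i
      = -(((p : ℝ) + 2) / n) * contr (symCov Γ (L (n - 1) (p + 1))) Q q i
  cond_b : 1 ≤ p → ∀ k, 2 ≤ k → k ≤ n → ∀ q ∈ U, ∀ i : Fin (p + 1) → Fin d,
    symCov Γ (L (k - 1) p) q i
      = -(((p : ℝ) + 2) / ((k : ℝ) - 1)) * contr (symCov Γ (L (k - 2) (p + 1))) Q q i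
        - k * L k (p + 1) q i
  cond_c : 1 ≤ p → ∀ q ∈ U, ∀ i : Fin (p + 1) → Fin d,
    symCov Γ (L 0 p) q i = ((p : ℝ) + 2) * contr C Q q i - L 1 (p + 1) q i
  /- Rank `r = l + 1` with `2 ≤ r ≤ m - 2`. -/
  cond_d : ∀ l, 1 ≤ l → l + 1 ≤ p → ∀ q ∈ U, ∀ i : Fin (l + 1) → Fin d,
    symCov Γ (L n l) q i = ((l : ℝ) + 2) * contr (L n (l + 2)) Q q i
  cond_e : ∀ k, 1 ≤ k → k ≤ n → ∀ l, 1 ≤ l → l + 1 ≤ p → ∀ q ∈ U,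
    ∀ i : Fin (l + 1) → Fin d,
    symCov Γ (L (k - 1) l) q i
      = ((l : ℝ) + 2) * contr (L (k - 1) (l + 2)) Q q i - k * L k (l + 1) q i
  /- Rank `1`. -/
  cond_g : 1 ≤ n → ∀ q ∈ U, ∀ a : Fin d,
    pderiv (pairing (L (n - 1) 1) Q) q a
      = 2 * n * contr (rankTwo Γ p C L n) Q q (fun _ => a)
  cond_h : ∀ k, 2 ≤ k → k ≤ n → ∀ q ∈ U, ∀ a : Fin d,
    pderiv (pairing (L (k - 2) 1) Q) q a
      = 2 * ((k : ℝ) - 1) * contr (rankTwo Γ p C L (k - 1)) Q q (fun _ => a)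
        - k * ((k : ℝ) - 1) * L k 1 q (fun _ => a)
  cond_i : ∀ q ∈ U, ∀ a : Fin d,
    pderiv G q a = 2 * contr (rankTwo Γ p C L 0) Q q (fun _ => a) - L 1 1 q (fun _ => a)

/-- The function `I_e^{(m)}`, `m = p + 2`. -/
def integralExp {d : ℕ} (p : ℕ) (Γ : Conn d) (Q : Coord d → Coord d) (lam : ℝ)
    (L : (r : ℕ) → Field d r) : ℝ → Coord d → Coord d → ℝ :=
  fun t q v => Real.exp (lam * t) / lam *
    (-(evalVel (symCov Γ (L (p + 1)) q) v)
      + lam * ∑ r ∈ Finset.Icc 1 (p + 1), evalVel (L r q) v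
      + pairing (L 1) Q q)

/-- `L_{i₁ i₂}`, the rank-two coefficient of `e^{λt}`. If `m = 2` this is the coefficient
`-(1/λ) L_{(i₁|i₂)}` of highest rank; if `m ≥ 3` it is a member of the family `L`. -/
def rankTwoExp {d : ℕ} (Γ : Conn d) (lam : ℝ) : ℕ → ((r : ℕ) → Field d r) → Field d 2
  | 0, L => fun q i => -(1 / lam) * symCov Γ (L 1) q i
  | _ + 1, L => L 2

/-- The conditions on the data `L_{i₁…i_r}`, `1 ≤ r ≤ m - 1`, of `I_e^{(m)}`, `m = p + 2`. -/
structure IsExpData {d : ℕ} (p : ℕ) (U : Set (Coord d)) (Γ : Conn d) (Q : Coord d → Coord d)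
    (lam : ℝ) (L : (r : ℕ) → Field d r) : Prop where
  L_symm : ∀ r, 1 ≤ r → r ≤ p + 1 → IsSymmTensor U (L r)
  L_killing : IsKilling U Γ (symCov Γ (L (p + 1)))
  cond_a : 1 ≤ p → ∀ q ∈ U, ∀ i : Fin (p + 1) → Fin d,
    symCov Γ (L p) q i
      = -(((p : ℝ) + 2) / lam) * contr (symCov Γ (L (p + 1))) Q q i - lam * L (p + 1) q i
  cond_b : ∀ l, 1 ≤ l → l + 1 ≤ p → ∀ q ∈ U, ∀ i : Fin (l + 1) → Fin d,
    symCov Γ (L l) q i = ((l : ℝ) + 2) * contr (L (l + 2)) Q q i - lam * L (l + 1) q i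
  cond_c : ∀ q ∈ U, ∀ a : Fin d,
    pderiv (pairing (L 1) Q) q a
      = 2 * lam * contr (rankTwoExp Γ lam p L) Q q (fun _ => a)
        - lam ^ 2 * L 1 q (fun _ => a)

/-- The function `M(t,q) + ∑_{r=1}^m M_{i₁…i_r}(t,q) v^{i₁} … v^{i_r}`. -/
def velPoly {d : ℕ} (m : ℕ) (M₀ : ℝ → Coord d → ℝ) (M : (r : ℕ) → ℝ → Field d r) :
    ℝ → Coord d → Coord d → ℝ :=
  fun t q v => M₀ t q + ∑ r ∈ Finset.Icc 1 m, evalVel (M r t q) v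

end

end FirstIntegrals

/-! Along a solution, the derivative of `∑_r M_{i₁…i_r} v^{i₁}…v^{i_r}` is again a polynomial in the
velocity. Its coefficient of rank `r` is `∂_t M_r + M_{r-1(…|i_r)} - (r+1) M_{r+1…c} Q^c` for `r ≥
1`, and `∂_t M_0 - M_c Q^c` for `r = 0`: the covariant derivative raises the degree by one, the
force lowers it by one (`hasDerivAt_coeffSum`). Through every `(t, q, v)` with `q ∈ U` passes a
solution (`exists_isSolution`), and a symmetric tensor is determined by its values on velocities
(`eq_zero_of_evalVel_eq_zero`). So a function of this form is a first integral iff all these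
coefficients vanish on `U`: the determining equations.

If the coefficients are combinations of `t^N` and `e^{λt}`, linear independence of these functions
(`pow_exp_independent`) splits the determining equations: `(N+1) A_{N+1} + D A_N = 0` for the powers
and `λ B + D B = 0` for each exponential, where `D` is `detCoeff`. Read rank by rank, these are the
conditions defining the two types. Rank `m+1` makes the coefficients of rank `m` Killing tensors,
rank `m` expresses these through `L_{i₁…i_{m-1}}`, ranks `1,…,m-1` give the listed conditions, and
rank `0` fixes the scalar part up to a function of `q`. `IsExpRepr` and `IsPolyRepr` relate
coefficients to data, so the equivalence can be used in both directions.

In the polynomial and mixed cases nothing is assumed about how `M_0` depends on `t`. The rank `0`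
equation says `∂_t M_0 = M_c Q^c`, and integration shows that `M_0` is a combination of the same
kind, of degree at most `n+1` (`base_eq_of_isFirstIntegral`). Connectedness enters once: the
gradient of `L_{(n)c} Q^c` vanishes, so this function is a constant `s`. -/

namespace FirstIntegrals
noncomputable section

/-! ### Differentiating polynomials in the velocity. -/

/-- The part of the time derivative of `T_{i₁…i_r} v^{i₁} … v^{i_r}` that comes from `v̇ = a`. -/
def velDeriv {d r : ℕ} (T : (Fin r → Fin d) → ℝ) (v a : Coord d) : ℝ :=
  ∑ i : Fin r → Fin d, T i * ∑ j, (∏ l ∈ Finset.univ.erase j, v (i l)) * a (i j)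

theorem hasDerivAt_evalVel {d r : ℕ} {T : ℝ → (Fin r → Fin d) → ℝ} {T' : (Fin r → Fin d) → ℝ}
    {v : ℝ → Coord d} {a : Coord d} {t : ℝ} (hT : ∀ i, HasDerivAt (fun τ => T τ i) (T' i) t)
    (hv : HasDerivAt v a t) :
    HasDerivAt (fun τ => evalVel (T τ) (v τ)) (evalVel T' (v t) + velDeriv (T t) (v t) a) t := by
  unfold evalVel velDeriv
  rw [← Finset.sum_add_distrib]
  refine HasDerivAt.fun_sum fun i _ => ?_
  have hprod : HasDerivAt (fun τ => ∏ j, v τ (i j))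
      (∑ j, (∏ l ∈ Finset.univ.erase j, v t (i l)) * a (i j)) t := by
    have := HasDerivAt.fun_finsetProd (u := Finset.univ) (f := fun j τ => v τ (i j))
      (f' := fun j => a (i j)) (x := t) (fun j _ => (hasDerivAt_pi.1 hv) (i j))
    simpa [smul_eq_mul] using this
  exact (hT i).mul hprod

theorem velDeriv_sub {d r : ℕ} (T : (Fin r → Fin d) → ℝ) (v a b : Coord d) :
    velDeriv T v (fun c => a c - b c) = velDeriv T v a - velDeriv T v b := by
  unfold velDeriv
  simp only [mul_sub, Finset.sum_sub_distrib]

theorem velDeriv_neg {d r : ℕ} (T : (Fin r → Fin d) → ℝ) (v a : Coord d) :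
    velDeriv T v (fun c => -a c) = -velDeriv T v a := by
  unfold velDeriv
  simp only [mul_neg, Finset.sum_neg_distrib]

/-- A product over all indices, unlike one over an erased set, can be reindexed by a permutation. -/
theorem prod_erase_eq_prod_ite {r : ℕ} (f : Fin r → ℝ) (j : Fin r) :
    ∏ l ∈ Finset.univ.erase j, f l = ∏ l, if l = j then 1 else f l := by
  rw [← Finset.mul_prod_erase Finset.univ _ (Finset.mem_univ j), if_pos rfl, one_mul]
  exact Finset.prod_congr rfl fun l hl => by rw [if_neg (Finset.ne_of_mem_erase hl)]

theorem sum_snoc {d r : ℕ} (f : (Fin (r + 1) → Fin d) → ℝ) :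
    ∑ i, f i = ∑ i : Fin r → Fin d, ∑ c, f (Fin.snoc (α := fun _ => Fin d) i c) := by
  rw [← (Fin.snocEquiv (fun _ : Fin (r + 1) => Fin d)).sum_comp, Fintype.sum_prod_type,
    Finset.sum_comm]
  rfl

theorem sum_comp_perm {d r : ℕ} (σ : Equiv.Perm (Fin r)) (f : (Fin r → Fin d) → ℝ) :
    ∑ i, f (i ∘ σ) = ∑ i, f i :=
  (Equiv.arrowCongr σ.symm (Equiv.refl (Fin d))).sum_comp f

/-- By symmetry each of the `r + 1` slots contributes the same contraction with `Q`. -/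
theorem velDeriv_eq_contr {d r : ℕ} {T : Field d (r + 1)} {q : Coord d} (Q : Coord d → Coord d)
    (hT : ∀ (σ : Equiv.Perm (Fin (r + 1))) (i : Fin (r + 1) → Fin d), T q (i ∘ σ) = T q i)
    (v : Coord d) :
    velDeriv (T q) v (Q q) = ((r : ℝ) + 1) * evalVel (contr T Q q) v := by
  have key : ∀ j : Fin (r + 1),
      ∑ i : Fin (r + 1) → Fin d, T q i * ((∏ l ∈ Finset.univ.erase j, v (i l)) * Q q (i j))
        = evalVel (contr T Q q) v := by
    intro j
    -- The transposition moves the distinguished slot `j` to the last place, where `contr`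
    -- contracts.
    rw [← sum_comp_perm (Equiv.swap j (Fin.last r)), sum_snoc, evalVel]
    refine Finset.sum_congr rfl fun i _ => ?_
    rw [contr, Finset.sum_mul]
    refine Finset.sum_congr rfl fun c _ => ?_
    rw [hT]
    have h1 : (∏ l ∈ Finset.univ.erase j, v (((Fin.snoc (α := fun _ => Fin d) i c) ∘
        (Equiv.swap j (Fin.last r))) l)) = ∏ l, v (i l) := by
      rw [prod_erase_eq_prod_ite (fun l => v (((Fin.snoc (α := fun _ => Fin d) i c) ∘
        (Equiv.swap j (Fin.last r))) l)), ← Equiv.prod_comp (Equiv.swap j (Fin.last r)),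
        Fin.prod_univ_castSucc]
      simp only [Function.comp, Equiv.swap_apply_self, Equiv.swap_apply_right, if_true, mul_one,
        Equiv.swap_apply_self]
      refine Finset.prod_congr rfl fun l _ => ?_
      have : (Equiv.swap j (Fin.last r)) l.castSucc ≠ j := by
        rw [Ne, Equiv.swap_apply_eq_iff, Equiv.swap_apply_left]
        exact (Fin.castSucc_lt_last l).ne
      rw [if_neg this]
      simp
    rw [h1]
    simp only [Function.comp, Equiv.swap_apply_left, Fin.snoc_last]
    ring
  unfold velDeriv
  simp only [Finset.mul_sum]
  rw [Finset.sum_comm, Finset.sum_congr rfl fun j _ => key j]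
  simp

theorem velDeriv_zero_rank {d : ℕ} (T : (Fin 0 → Fin d) → ℝ) (v a : Coord d) :
    velDeriv T v a = 0 := by
  simp [velDeriv]

/-- The substitution `(i, c) ↦ (i with c in the j-th place, i_j)`. -/
def updateSwap {d r : ℕ} (j : Fin r) : Equiv.Perm ((Fin r → Fin d) × Fin d) :=
  Function.Involutive.toPerm (fun x => (Function.update x.1 j x.2, x.1 j)) fun x => by simp

theorem updateSwap_apply {d r : ℕ} (j : Fin r) (x : (Fin r → Fin d) × Fin d) :
    updateSwap j x = (Function.update x.1 j x.2, x.1 j) := rfl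

/-- Contraction with equal velocities makes all terms of the symmetrization equal. In the connection
terms, exchanging the dummy index `c` with `i_j` turns the replacement of `i_j` in `T` into the
replacement of `v^{i_j}` by `Γ^{i_j}_{bc} v^b v^c`. -/
theorem evalVel_symCov {d r : ℕ} (Γ : Conn d) (T : Field d r) (q v : Coord d) :
    evalVel (symCov Γ T q) v
      = evalVel (fun i => ∑ k, pderiv (fun x => T x i) q k * v k) v
        - velDeriv (T q) v (fun a => ∑ b, ∑ c, Γ q a b c * v b * v c) := by
  have h1 : evalVel (symCov Γ T q) v = ∑ i : Fin (r + 1) → Fin d,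
      covDeriv Γ T q (fun j => i j.castSucc) (i (Fin.last r)) * ∏ j, v (i j) := by
    have hσ : ∀ σ : Equiv.Perm (Fin (r + 1)), ∑ i : Fin (r + 1) → Fin d,
        covDeriv Γ T q (fun j => i (σ j.castSucc)) (i (σ (Fin.last r))) * ∏ j, v (i j)
        = ∑ i : Fin (r + 1) → Fin d,
          covDeriv Γ T q (fun j => i j.castSucc) (i (Fin.last r)) * ∏ j, v (i j) := by
      intro σ
      rw [← sum_comp_perm σ (fun i => covDeriv Γ T q (fun j => i j.castSucc) (i (Fin.last r)) *
        ∏ j, v (i j))]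
      refine Finset.sum_congr rfl fun i _ => ?_
      simp only [Function.comp]
      rw [Equiv.prod_comp σ (fun j => v (i j))]
    unfold evalVel symCov
    simp only [mul_assoc, Finset.sum_mul]
    rw [← Finset.mul_sum, Finset.sum_comm, Finset.sum_congr rfl fun σ _ => hσ σ]
    simp only [Finset.sum_const, Finset.card_univ, Fintype.card_perm, Fintype.card_fin,
      nsmul_eq_mul]
    rw [inv_mul_cancel_left₀ (Nat.cast_ne_zero.2 (Nat.factorial_ne_zero _))]
  rw [h1, sum_snoc]
  simp only [Fin.snoc_castSucc, Fin.snoc_last, Fin.prod_univ_castSucc, covDeriv, sub_mul,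
    Finset.sum_sub_distrib]
  congr 1
  · unfold evalVel
    refine Finset.sum_congr rfl fun i _ => ?_
    rw [Finset.sum_mul]
    exact Finset.sum_congr rfl fun k _ => by ring
  · unfold velDeriv
    simp only [Finset.mul_sum, Finset.sum_mul]
    rw [Finset.sum_congr rfl fun i _ => Finset.sum_comm, Finset.sum_comm,
      Finset.sum_comm (s := Finset.univ (α := Fin r → Fin d))]
    refine Finset.sum_congr rfl fun j _ => ?_
    have hs := Equiv.sum_comp (updateSwap (d := d) j) fun x : (Fin r → Fin d) × Fin d =>
      ∑ k, T q x.1 * ((∏ l ∈ Finset.univ.erase j, v (x.1 l)) * (Γ q (x.1 j) x.2 k * v x.2 * v k))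
    rw [Fintype.sum_prod_type, Fintype.sum_prod_type] at hs
    rw [← hs]
    refine Finset.sum_congr rfl fun i _ => ?_
    rw [Finset.sum_comm]
    refine Finset.sum_congr rfl fun c _ => Finset.sum_congr rfl fun k _ => ?_
    have h2 : ∏ l ∈ Finset.univ.erase j, v (Function.update i j c l)
        = ∏ l ∈ Finset.univ.erase j, v (i l) :=
      Finset.prod_congr rfl fun l hl => by
        rw [Function.update_of_ne (Finset.ne_of_mem_erase hl)]
    simp only [updateSwap_apply, Function.update_self, h2]
    rw [← Finset.mul_prod_erase Finset.univ _ (Finset.mem_univ j)]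
    ring

/-! ### The determining equations. -/

/-- The coefficients, as a polynomial in the velocity, of the total time derivative of
`∑_r T_{i₁…i_r}(q) v^{i₁} … v^{i_r}`. -/
def detCoeff {d : ℕ} (Γ : Conn d) (Q : Coord d → Coord d) (T : (r : ℕ) → Field d r) :
    (r : ℕ) → Field d r
  | 0 => fun q i => -contr (T 1) Q q i
  | r + 1 => fun q i => symCov Γ (T r) q i - ((r : ℝ) + 2) * contr (T (r + 2)) Q q i

theorem detCoeff_zero {d : ℕ} (Γ : Conn d) (Q : Coord d → Coord d) (T : (r : ℕ) → Field d r)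
    (q : Coord d) (i : Fin 0 → Fin d) : detCoeff Γ Q T 0 q i = -contr (T 1) Q q i := rfl

theorem detCoeff_succ {d : ℕ} (Γ : Conn d) (Q : Coord d → Coord d) (T : (r : ℕ) → Field d r)
    (r : ℕ) (q : Coord d) (i : Fin (r + 1) → Fin d) :
    detCoeff Γ Q T (r + 1) q i
      = symCov Γ (T r) q i - ((r : ℝ) + 2) * contr (T (r + 2)) Q q i := rfl

/-- Partial time derivative of a family of time dependent tensors. -/
def timeDeriv {d : ℕ} (M : (r : ℕ) → ℝ → Field d r) (t : ℝ) (r : ℕ) : Field d r :=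
  fun q i => deriv (fun τ => M r τ q i) t

/-- The function `∑_{r=0}^m M_{i₁…i_r}(t,q) v^{i₁} … v^{i_r}`. -/
def coeffSum {d : ℕ} (m : ℕ) (M : (r : ℕ) → ℝ → Field d r) : ℝ → Coord d → Coord d → ℝ :=
  fun t q v => ∑ r ∈ Finset.range (m + 1), evalVel (M r t q) v

/-- Differentiable symmetric coefficients of a polynomial of degree at most `m` in the velocity. -/
structure IsCoeffFamily {d : ℕ} (U : Set (Coord d)) (m : ℕ) (M : (r : ℕ) → ℝ → Field d r) :
    Prop where
  diff : ∀ r i t, ∀ q ∈ U, DifferentiableAt ℝ (fun x : ℝ × Coord d => M r x.1 x.2 i) (t, q)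
  symm : ∀ r t, ∀ q ∈ U, ∀ (σ : Equiv.Perm (Fin r)) (i : Fin r → Fin d),
    M r t q (i ∘ σ) = M r t q i
  eq_zero : ∀ r, m < r → M r = 0

/-- The chain rule on `ℝ × Coord d`, with the direction split as `(1, v) = (1, 0) + (0, v)`. -/
theorem hasDerivAt_along {d : ℕ} {F : ℝ × Coord d → ℝ} {q : ℝ → Coord d} {v : Coord d} {t : ℝ}
    (hF : DifferentiableAt ℝ F (t, q t)) (hq : HasDerivAt q v t) :
    HasDerivAt (fun τ => F (τ, q τ))
      (deriv (fun τ => F (τ, q t)) t + ∑ k, pderiv (fun x => F (t, x)) (q t) k * v k) t := by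
  have h1 : HasDerivAt (fun τ => F (τ, q τ)) (fderiv ℝ F (t, q t) (1, v)) t :=
    hF.hasFDerivAt.comp_hasDerivAt t ((hasDerivAt_id t).prodMk hq)
  have h2 : deriv (fun τ => F (τ, q t)) t = fderiv ℝ F (t, q t) (1, 0) :=
    (hF.hasFDerivAt.comp_hasDerivAt t ((hasDerivAt_id t).prodMk (hasDerivAt_const t (q t)))).deriv
  have h3 : HasFDerivAt (fun x => F (t, x))
      ((fderiv ℝ F (t, q t)).comp (ContinuousLinearMap.inr ℝ ℝ (Coord d))) (q t) :=
    hF.hasFDerivAt.comp (q t) (hasFDerivAt_prodMk_right t (q t))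
  convert h1 using 1
  rw [h2]
  simp only [pderiv, h3.fderiv]
  have h4 := LinearMap.pi_apply_eq_sum_univ
    ((fderiv ℝ F (t, q t)).comp (ContinuousLinearMap.inr ℝ ℝ (Coord d))).toLinearMap v
  have h5 : ((1 : ℝ), v) = (1, 0) + (0, v) := by simp
  rw [h5, map_add]
  congr 1
  simp only [ContinuousLinearMap.coe_coe, ContinuousLinearMap.comp_apply,
    ContinuousLinearMap.inr_apply] at h4 ⊢
  rw [h4]
  refine Finset.sum_congr rfl fun k _ => ?_
  rw [smul_eq_mul, mul_comm]
  congr 3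
  ext j
  simp [Pi.single_apply, eq_comm]

theorem evalVel_add {d r : ℕ} (S T : (Fin r → Fin d) → ℝ) (v : Coord d) :
    evalVel (fun i => S i + T i) v = evalVel S v + evalVel T v := by
  simp only [evalVel, add_mul, Finset.sum_add_distrib]

theorem evalVel_sub {d r : ℕ} (S T : (Fin r → Fin d) → ℝ) (v : Coord d) :
    evalVel (fun i => S i - T i) v = evalVel S v - evalVel T v := by
  simp only [evalVel, sub_mul, Finset.sum_sub_distrib]

theorem evalVel_mul {d r : ℕ} (a : ℝ) (T : (Fin r → Fin d) → ℝ) (v : Coord d) :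
    evalVel (fun i => a * T i) v = a * evalVel T v := by
  simp only [evalVel, Finset.mul_sum, mul_assoc]

theorem evalVel_neg {d r : ℕ} (T : (Fin r → Fin d) → ℝ) (v : Coord d) :
    evalVel (fun i => -T i) v = -evalVel T v := by
  simp only [evalVel, neg_mul, Finset.sum_neg_distrib]

theorem evalVel_zero {d r : ℕ} (v : Coord d) : evalVel (0 : (Fin r → Fin d) → ℝ) v = 0 := by
  simp [evalVel]

theorem evalVel_sum {d r : ℕ} {α : Type*} (s : Finset α) (T : α → (Fin r → Fin d) → ℝ)
    (v : Coord d) : evalVel (fun i => ∑ x ∈ s, T x i) v = ∑ x ∈ s, evalVel (T x) v := by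
  simp only [evalVel, Finset.sum_mul]
  exact Finset.sum_comm

theorem contr_zero {d r : ℕ} (Q : Coord d → Coord d) : contr (0 : Field d (r + 1)) Q = 0 := by
  ext q i
  simp [contr]

theorem timeDeriv_eq_zero {d : ℕ} {M : (r : ℕ) → ℝ → Field d r} {r : ℕ} (h : M r = 0) (t : ℝ) :
    timeDeriv M t r = 0 := by
  ext q i
  simp [timeDeriv, h]

theorem hasDerivAt_coeffSum {d m : ℕ} {U : Set (Coord d)} {Γ : Conn d} {Q : Coord d → Coord d}
    {M : (r : ℕ) → ℝ → Field d r} (hM : IsCoeffFamily U m M) {q v : ℝ → Coord d} {t : ℝ}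
    (hqU : q t ∈ U) (hq : HasDerivAt q (v t) t)
    (hv : HasDerivAt v (accel Γ Q (q t) (v t)) t) :
    HasDerivAt (fun τ => coeffSum m M τ (q τ) (v τ))
      (∑ r ∈ Finset.range (m + 2),
        evalVel (fun i => timeDeriv M t r (q t) i
          + detCoeff Γ Q (fun r => M r t) r (q t) i) (v t)) t := by
  have hr : ∀ r, HasDerivAt (fun τ => evalVel (M r τ (q τ)) (v τ))
      (evalVel (timeDeriv M t r (q t)) (v t) + evalVel (symCov Γ (M r t) (q t)) (v t)
        - velDeriv (M r t (q t)) (v t) (Q (q t))) t := by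
    intro r
    have h := hasDerivAt_evalVel (T := fun τ i => M r τ (q τ) i)
      (fun i => hasDerivAt_along (hM.diff r i t (q t) hqU) hq) hv
    convert h using 1
    rw [evalVel_symCov, evalVel_add]
    unfold accel
    rw [velDeriv_sub, velDeriv_neg]
    unfold timeDeriv
    ring
  have hsum := HasDerivAt.fun_sum (u := Finset.range (m + 1)) fun r _ => hr r
  refine hsum.congr_deriv ?_
  -- The covariant derivative of the rank `m` member has rank `m + 1`, so all sums are brought to
  -- `range (m + 2)`; the added terms vanish.
  have e1 : ∑ r ∈ Finset.range (m + 1), evalVel (timeDeriv M t r (q t)) (v t)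
      = ∑ r ∈ Finset.range (m + 2), evalVel (timeDeriv M t r (q t)) (v t) := by
    rw [Finset.sum_range_succ _ (m + 1),
      timeDeriv_eq_zero (hM.eq_zero (m + 1) (Nat.lt_succ_self m)), Pi.zero_apply, evalVel_zero,
      add_zero]
  -- Contraction with `Q` lowers the rank by one: rank `0` drops out and the index shifts.
  have e2 : ∑ r ∈ Finset.range (m + 1), velDeriv (M r t (q t)) (v t) (Q (q t))
      = ∑ r ∈ Finset.range (m + 2), ((r : ℝ) + 1) * evalVel (contr (M (r + 1) t) Q (q t)) (v t) := by
    rw [Finset.sum_range_succ', velDeriv_zero_rank, add_zero, Finset.sum_range_succ,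
      Finset.sum_range_succ, hM.eq_zero (m + 1) (Nat.lt_succ_self m),
      hM.eq_zero (m + 1 + 1) (by omega)]
    simp only [Pi.zero_apply, contr_zero, evalVel_zero, mul_zero, add_zero]
    exact Finset.sum_congr rfl fun r _ =>
      velDeriv_eq_contr Q (hM.symm (r + 1) t (q t) hqU) (v t)
  rw [Finset.sum_sub_distrib, Finset.sum_add_distrib, e1, e2, Finset.sum_range_succ' _ (m + 1),
    Finset.sum_range_succ' _ (m + 1), Finset.sum_range_succ' _ (m + 1)]
  simp only [detCoeff, evalVel_sub, evalVel_add, evalVel_mul, evalVel_neg, Finset.sum_sub_distrib,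
    Finset.sum_add_distrib]
  push_cast
  simp only [add_assoc, one_add_one_eq_two]
  ring

/-! ### From first integrals to vanishing coefficients, and back. -/

/-- Picard–Lindelöf for the first-order system on `(q, v)`; the time interval is then shrunk so that
`q` stays in the open set `U`. -/
theorem exists_isSolution {d : ℕ} {U : Set (Coord d)} (hU : IsOpen U) {Γ : Conn d}
    (hΓ : ContDiffOn ℝ (⊤ : ℕ∞) Γ U) {Q : Coord d → Coord d} (hQ : ContDiffOn ℝ (⊤ : ℕ∞) Q U)
    (t : ℝ) {q₀ : Coord d} (hq₀ : q₀ ∈ U) (v₀ : Coord d) :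
    ∃ (q v : ℝ → Coord d) (ε : ℝ), 0 < ε ∧ q t = q₀ ∧ v t = v₀ ∧
      IsSolution U Γ Q (t - ε) (t + ε) q v := by
  have hf : ContDiffAt ℝ 1 (fun x : Coord d × Coord d => (x.2, accel Γ Q x.1 x.2)) (q₀, v₀) := by
    have hΓ1 : ContDiffAt ℝ 1 Γ q₀ := (hΓ.contDiffAt (hU.mem_nhds hq₀)).of_le (by exact_mod_cast le_top)
    have hQ1 : ContDiffAt ℝ 1 Q q₀ := (hQ.contDiffAt (hU.mem_nhds hq₀)).of_le (by exact_mod_cast le_top)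
    have hΓ2 : ContDiffAt ℝ 1 (fun x : Coord d × Coord d => Γ x.1) (q₀, v₀) :=
      hΓ1.comp (q₀, v₀) contDiffAt_fst
    have hQ2 : ContDiffAt ℝ 1 (fun x : Coord d × Coord d => Q x.1) (q₀, v₀) :=
      hQ1.comp (q₀, v₀) contDiffAt_fst
    have hv : ∀ b : Fin d, ContDiffAt ℝ 1 (fun x : Coord d × Coord d => x.2 b) (q₀, v₀) := fun b =>
      contDiffAt_pi.1 contDiffAt_snd b
    refine contDiffAt_snd.prodMk (contDiffAt_pi.2 fun a => ?_)
    refine (ContDiffAt.neg ?_).sub (contDiffAt_pi.1 hQ2 a)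
    refine ContDiffAt.sum fun b _ => ContDiffAt.sum fun c _ => ?_
    exact ((contDiffAt_pi.1 (contDiffAt_pi.1 (contDiffAt_pi.1 hΓ2 a) b) c).mul (hv b)).mul (hv c)
  obtain ⟨α, hα0, ε, hε, hα⟩ :=
    hf.exists_forall_mem_closedBall_exists_eq_forall_mem_Ioo_hasDerivAt₀ t
  have hcont : ContinuousAt (fun τ => (α τ).1) t :=
    (hα t ⟨by linarith, by linarith⟩).continuousAt.fst
  have hmem : (fun τ => (α τ).1) ⁻¹' U ∈ nhds t :=
    hcont.preimage_mem_nhds (hU.mem_nhds (by simpa [hα0] using hq₀))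
  obtain ⟨δ, hδ, hball⟩ := Metric.mem_nhds_iff.1 hmem
  refine ⟨fun τ => (α τ).1, fun τ => (α τ).2, min ε δ, lt_min hε hδ, by simp [hα0], by simp [hα0],
    fun τ hτ => ?_⟩
  have h1 := hα τ ⟨by linarith [hτ.1, min_le_left ε δ], by linarith [hτ.2, min_le_left ε δ]⟩
  refine ⟨hball ?_, h1.fst, h1.snd⟩
  rw [Metric.mem_ball, Real.dist_eq, abs_lt]
  constructor <;> linarith [hτ.1, hτ.2, min_le_right ε δ]

/-- Two index tuples with the same number of occurrences of each index differ by a permutation. -/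
theorem exists_perm_of_count_eq {d r : ℕ} {i j : Fin r → Fin d}
    (h : ∀ c, (Finset.univ.filter fun l => i l = c).card
      = (Finset.univ.filter fun l => j l = c).card) :
    ∃ σ : Equiv.Perm (Fin r), j ∘ σ = i := by
  -- The fibres over each value are equinumerous; bijections between them glue to a permutation.
  have e : ∀ c, Nonempty ({l // i l = c} ≃ {l // j l = c}) := fun c => by
    refine ⟨Fintype.equivOfCardEq ?_⟩
    rw [Fintype.card_subtype, Fintype.card_subtype, h c]
  exact ⟨Equiv.ofFiberEquiv fun c => (e c).some, funext fun l => Equiv.ofFiberEquiv_map _ l⟩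

/-- A real polynomial vanishing at all points is zero. The coefficient of the monomial of `i` is `T
i` times the number of distinct rearrangements of `i`, by symmetry of `T`. -/
theorem eq_zero_of_evalVel_eq_zero {d r : ℕ} {T : (Fin r → Fin d) → ℝ}
    (hT : ∀ (σ : Equiv.Perm (Fin r)) (i : Fin r → Fin d), T (i ∘ σ) = T i)
    (h : ∀ v, evalVel T v = 0) (i : Fin r → Fin d) : T i = 0 := by
  let P : MvPolynomial (Fin d) ℝ := ∑ j : Fin r → Fin d,
    MvPolynomial.monomial (∑ l, Finsupp.single (j l) 1) (T j)
  have hP : P = 0 := by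
    refine MvPolynomial.funext fun v => ?_
    rw [map_zero, ← h v, evalVel, map_sum]
    refine Finset.sum_congr rfl fun j _ => ?_
    rw [MvPolynomial.monomial_sum_index, map_mul, MvPolynomial.eval_C, map_prod]
    congr 1
    refine Finset.prod_congr rfl fun l _ => ?_
    simp [MvPolynomial.eval_monomial]
  have hcoeff := congrArg (MvPolynomial.coeff (∑ l, Finsupp.single (i l) 1)) hP
  simp only [P, MvPolynomial.coeff_sum, MvPolynomial.coeff_monomial, MvPolynomial.coeff_zero]
    at hcoeff
  have hterm : ∀ j : Fin r → Fin d,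
      (if (∑ l, Finsupp.single (j l) 1 : Fin d →₀ ℕ) = ∑ l, Finsupp.single (i l) 1 then T j else 0)
        = (if (∑ l, Finsupp.single (j l) 1 : Fin d →₀ ℕ) = ∑ l, Finsupp.single (i l) 1
            then 1 else 0) * T i := by
    intro j
    split_ifs with hj
    · obtain ⟨σ, hσ⟩ := exists_perm_of_count_eq (i := j) (j := i) fun c => by
        have := DFunLike.congr_fun hj c
        simpa [Finsupp.finsetSum_apply, Finsupp.single_apply] using this
      rw [one_mul, ← hσ, hT]
    · rw [zero_mul]
  rw [Finset.sum_congr rfl fun j _ => hterm j, ← Finset.sum_mul] at hcoeff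
  -- The number of rearrangements is positive, since `i` is one of them.
  refine (mul_eq_zero.1 hcoeff).resolve_left (ne_of_gt ?_)
  refine Finset.sum_pos' (fun j _ => by split_ifs <;> norm_num) ⟨i, Finset.mem_univ i, by simp⟩

/-- The homogeneous components of a polynomial in the velocity that vanishes are zero. -/
theorem evalVel_eq_zero_of_sum {d k : ℕ} {T : (r : ℕ) → (Fin r → Fin d) → ℝ}
    (h : ∀ v, ∑ r ∈ Finset.range k, evalVel (T r) v = 0) {r : ℕ} (hr : r < k) (v : Coord d) :
    evalVel (T r) v = 0 := by
  -- Rescaling `v` to `x v` multiplies the component of degree `r` by `x ^ r`, so the components at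
  -- `v` are the coefficients of a polynomial in `x` that vanishes identically.
  let P : Polynomial ℝ := ∑ r ∈ Finset.range k, Polynomial.monomial r (evalVel (T r) v)
  have hP : P = 0 := by
    refine Polynomial.funext fun x => ?_
    rw [Polynomial.eval_zero, ← h (fun c => x * v c), Polynomial.eval_finsetSum]
    refine Finset.sum_congr rfl fun r _ => ?_
    simp only [Polynomial.eval_monomial, evalVel, Finset.prod_mul_distrib, Finset.prod_const,
      Finset.card_univ, Fintype.card_fin, Finset.sum_mul]
    exact Finset.sum_congr rfl fun i _ => by ring
  have := congrArg (fun p => Polynomial.coeff p r) hP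
  simpa [P, Polynomial.finsetSum_coeff, Polynomial.coeff_monomial, hr] using this

theorem IsFirstIntegral.congr {d : ℕ} {U : Set (Coord d)} {Γ : Conn d} {Q : Coord d → Coord d}
    {I J : ℝ → Coord d → Coord d → ℝ} (hI : IsFirstIntegral U Γ Q I)
    (h : ∀ t, ∀ q ∈ U, ∀ v, I t q v = J t q v) : IsFirstIntegral U Γ Q J := by
  intro t₀ t₁ q v hs t ht
  refine (hI t₀ t₁ q v hs t ht).congr_of_eventuallyEq ?_
  filter_upwards [Ioo_mem_nhds ht.1 ht.2] with τ hτ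
  exact (h τ (q τ) (hs τ hτ).1 (v τ)).symm

theorem symCov_symm {d r : ℕ} (Γ : Conn d) (T : Field d r) (q : Coord d)
    (σ : Equiv.Perm (Fin (r + 1))) (i : Fin (r + 1) → Fin d) :
    symCov Γ T q (i ∘ σ) = symCov Γ T q i := by
  unfold symCov
  congr 1
  exact Equiv.sum_comp (Equiv.mulLeft σ) fun τ : Equiv.Perm (Fin (r + 1)) =>
    covDeriv Γ T q (fun j => i (τ j.castSucc)) (i (τ (Fin.last r)))

theorem contr_symm {d r : ℕ} {T : Field d (r + 1)} {q : Coord d} (Q : Coord d → Coord d)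
    (hT : ∀ (σ : Equiv.Perm (Fin (r + 1))) (i : Fin (r + 1) → Fin d), T q (i ∘ σ) = T q i)
    (σ : Equiv.Perm (Fin r)) (i : Fin r → Fin d) : contr T Q q (i ∘ σ) = contr T Q q i := by
  unfold contr
  refine Finset.sum_congr rfl fun c _ => ?_
  -- This is `σ` extended to `Fin (r + 1)` by fixing the last place.
  rw [← hT ((finSuccEquivLast.trans (Equiv.optionCongr σ)).trans finSuccEquivLast.symm)
    (Fin.snoc (α := fun _ => Fin d) i c)]
  congr 2
  ext l
  refine Fin.lastCases ?_ (fun l => ?_) l <;> simp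

theorem detCoeff_symm {d : ℕ} (Γ : Conn d) (Q : Coord d → Coord d) {T : (r : ℕ) → Field d r}
    {q : Coord d}
    (hT : ∀ r (σ : Equiv.Perm (Fin r)) (i : Fin r → Fin d), T r q (i ∘ σ) = T r q i)
    (r : ℕ) (σ : Equiv.Perm (Fin r)) (i : Fin r → Fin d) :
    detCoeff Γ Q T r q (i ∘ σ) = detCoeff Γ Q T r q i := by
  cases r with
  | zero => rw [Subsingleton.elim (i ∘ σ) i]
  | succ r => simp only [detCoeff, symCov_symm, contr_symm Q (hT (r + 2))]

/-- The initial velocity is arbitrary, so the derivative vanishes as a polynomial in the velocity: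
first each homogeneous component, then each symmetric coefficient. -/
theorem timeDeriv_add_detCoeff_eq_zero {d m : ℕ} {U : Set (Coord d)} (hU : IsOpen U) {Γ : Conn d}
    (hΓ : ContDiffOn ℝ (⊤ : ℕ∞) Γ U) {Q : Coord d → Coord d} (hQ : ContDiffOn ℝ (⊤ : ℕ∞) Q U)
    {M : (r : ℕ) → ℝ → Field d r} (hM : IsCoeffFamily U m M)
    (hI : IsFirstIntegral U Γ Q (coeffSum m M)) (t : ℝ) {q : Coord d} (hq : q ∈ U) {r : ℕ}
    (hr : r < m + 2) (i : Fin r → Fin d) :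
    timeDeriv M t r q i + detCoeff Γ Q (fun r => M r t) r q i = 0 := by
  have h0 : ∀ v₀ : Coord d, ∑ r ∈ Finset.range (m + 2),
      evalVel (fun i => timeDeriv M t r q i + detCoeff Γ Q (fun r => M r t) r q i) v₀ = 0 := by
    intro v₀
    obtain ⟨x, v, ε, hε, rfl, rfl, hs⟩ := exists_isSolution hU hΓ hQ t hq v₀
    have ht : t ∈ Ioo (t - ε) (t + ε) := ⟨by linarith, by linarith⟩
    obtain ⟨h1, h2, h3⟩ := hs t ht
    exact (hasDerivAt_coeffSum hM h1 h2 h3).unique (hI _ _ x v hs t ht)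
  refine eq_zero_of_evalVel_eq_zero (T := fun i => timeDeriv M t r q i
    + detCoeff Γ Q (fun r => M r t) r q i) (fun σ i => ?_)
    (fun v => evalVel_eq_zero_of_sum (T := fun r i => timeDeriv M t r q i
      + detCoeff Γ Q (fun r => M r t) r q i) h0 hr v) i
  rw [detCoeff_symm Γ Q fun r => hM.symm r t q hq]
  congr 1
  unfold timeDeriv
  congr 1
  exact funext fun τ => hM.symm r τ q hq σ i

theorem isFirstIntegral_coeffSum {d m : ℕ} {U : Set (Coord d)} {Γ : Conn d}
    {Q : Coord d → Coord d} {M : (r : ℕ) → ℝ → Field d r} (hM : IsCoeffFamily U m M)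
    (h : ∀ t, ∀ q ∈ U, ∀ r < m + 2, ∀ i : Fin r → Fin d,
      timeDeriv M t r q i + detCoeff Γ Q (fun r => M r t) r q i = 0) :
    IsFirstIntegral U Γ Q (coeffSum m M) := by
  intro t₀ t₁ q v hs t ht
  obtain ⟨h1, h2, h3⟩ := hs t ht
  refine (hasDerivAt_coeffSum hM h1 h2 h3).congr_deriv (Finset.sum_eq_zero fun r hr => ?_)
  rw [show (fun i => timeDeriv M t r (q t) i + detCoeff Γ Q (fun r => M r t) r (q t) i) = 0 from
    funext fun i => h t (q t) h1 r (Finset.mem_range.1 hr) i, evalVel_zero]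

/-! ### Linearity of the operators and independence of powers and exponentials. -/

theorem symCov_sum {d r : ℕ} (Γ : Conn d) {α : Type*} (s : Finset α) (c : α → ℝ)
    {T : α → Field d r} {q : Coord d}
    (hT : ∀ x ∈ s, ∀ i, DifferentiableAt ℝ (fun y => T x y i) q) (i : Fin (r + 1) → Fin d) :
    symCov Γ (fun y i => ∑ x ∈ s, c x * T x y i) q i = ∑ x ∈ s, c x * symCov Γ (T x) q i := by
  have hcov : ∀ (j : Fin r → Fin d) (k : Fin d),
      covDeriv Γ (fun y i => ∑ x ∈ s, c x * T x y i) q j k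
        = ∑ x ∈ s, c x * covDeriv Γ (T x) q j k := by
    intro j k
    have hp : pderiv (fun y => ∑ x ∈ s, c x * T x y j) q k
        = ∑ x ∈ s, c x * pderiv (fun y => T x y j) q k := by
      unfold pderiv
      rw [fderiv_fun_sum fun x hx => (hT x hx j).const_mul (c x), sum_apply]
      refine Finset.sum_congr rfl fun x hx => ?_
      rw [fderiv_const_mul (hT x hx j)]
      rfl
    unfold covDeriv
    rw [hp]
    simp only [mul_sub, Finset.sum_sub_distrib, Finset.mul_sum]
    congr 1
    rw [Finset.sum_congr rfl fun l _ => Finset.sum_comm, Finset.sum_comm]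
    refine Finset.sum_congr rfl fun x _ => Finset.sum_congr rfl fun l _ =>
      Finset.sum_congr rfl fun e _ => by ring
  unfold symCov
  simp only [hcov, Finset.mul_sum]
  rw [Finset.sum_comm]
  refine Finset.sum_congr rfl fun x _ => Finset.sum_congr rfl fun σ _ => by ring

theorem contr_sum {d r : ℕ} (Q : Coord d → Coord d) {α : Type*} (s : Finset α) (c : α → ℝ)
    (T : α → Field d (r + 1)) (q : Coord d) (i : Fin r → Fin d) :
    contr (fun y i => ∑ x ∈ s, c x * T x y i) Q q i = ∑ x ∈ s, c x * contr (T x) Q q i := by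
  unfold contr
  simp only [Finset.mul_sum, Finset.sum_mul]
  rw [Finset.sum_comm]
  refine Finset.sum_congr rfl fun x _ => Finset.sum_congr rfl fun e _ => by ring

theorem detCoeff_sum {d : ℕ} (Γ : Conn d) (Q : Coord d → Coord d) {α : Type*} (s : Finset α)
    (c : α → ℝ) {T : α → (r : ℕ) → Field d r} {q : Coord d}
    (hT : ∀ x ∈ s, ∀ r i, DifferentiableAt ℝ (fun y => T x r y i) q) (r : ℕ)
    (i : Fin r → Fin d) :
    detCoeff Γ Q (fun r y i => ∑ x ∈ s, c x * T x r y i) r q i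
      = ∑ x ∈ s, c x * detCoeff Γ Q (T x) r q i := by
  cases r with
  | zero => simp only [detCoeff, contr_sum, mul_neg, Finset.sum_neg_distrib]
  | succ r =>
    simp only [detCoeff, contr_sum, symCov_sum Γ s c fun x hx => hT x hx r, mul_sub,
      Finset.sum_sub_distrib, Finset.mul_sum]
    congr 1
    exact Finset.sum_congr rfl fun x _ => by ring

open Polynomial in
/-- The functions `t^N` and `e^{λt}`, `λ ≠ 0`, are linearly independent. -/
theorem polynomial_exp_independent (S : Finset ℝ) (b : ℝ → ℝ) :
    ∀ P : ℝ[X], 0 ∉ S → (∀ t, P.eval t + ∑ lam ∈ S, Real.exp (lam * t) * b lam = 0) →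
      P = 0 ∧ ∀ lam ∈ S, b lam = 0 := by
  classical
  induction S using Finset.induction_on generalizing b with
  | empty =>
    intro P _ h
    exact ⟨Polynomial.funext fun t => by simpa using h t, by simp⟩
  | insert μ S hμ ih =>
    intro P h0 h
    rw [Finset.mem_insert, not_or] at h0
    have hμ0 : μ ≠ 0 := fun e => h0.1 e.symm
    -- The operator `d/dt - μ` kills `e^{μt}` and multiplies every other `e^{λt}` by `λ - μ ≠ 0`.
    have hder : ∀ t, (derivative P - C μ * P).eval t
        + ∑ lam ∈ S, Real.exp (lam * t) * ((lam - μ) * b lam) = 0 := by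
      intro t
      have h1 : HasDerivAt (fun t => P.eval t + ∑ lam ∈ insert μ S, Real.exp (lam * t) * b lam)
          ((derivative P).eval t + ∑ lam ∈ insert μ S, Real.exp (lam * t) * lam * b lam) t := by
        refine (P.hasDerivAt t).add (HasDerivAt.fun_sum fun lam _ => ?_)
        simpa using (((hasDerivAt_id t).const_mul lam).exp).mul_const (b lam)
      rw [funext h] at h1
      have h2 := h1.unique (hasDerivAt_const t (0 : ℝ))
      have h3 := h t
      rw [Finset.sum_insert hμ] at h2 h3
      have h4 : ∑ lam ∈ S, Real.exp (lam * t) * ((lam - μ) * b lam)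
          = ∑ lam ∈ S, Real.exp (lam * t) * lam * b lam
            - μ * ∑ lam ∈ S, Real.exp (lam * t) * b lam := by
        rw [Finset.mul_sum, ← Finset.sum_sub_distrib]
        exact Finset.sum_congr rfl fun lam _ => by ring
      rw [h4, eval_sub, eval_mul, eval_C]
      linear_combination h2 - μ * h3
    obtain ⟨hP, hb⟩ := ih (fun lam => (lam - μ) * b lam) _ h0.2 hder
    have hb' : ∀ lam ∈ S, b lam = 0 := fun lam hlam =>
      (mul_eq_zero.1 (hb lam hlam)).resolve_left (sub_ne_zero.2 fun e => hμ (e ▸ hlam))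
    -- `P' = μ P` with `μ ≠ 0` is impossible for `P ≠ 0`, as differentiation lowers the degree.
    have hP0 : P = 0 := by
      by_contra hne
      have hlt := Polynomial.degree_derivative_lt hne
      rw [sub_eq_zero.1 hP, Polynomial.degree_C_mul hμ0] at hlt
      exact lt_irrefl _ hlt
    refine ⟨hP0, fun lam hlam => ?_⟩
    rcases Finset.mem_insert.1 hlam with rfl | hlam
    · have h3 := h 0
      rw [Finset.sum_insert hμ, Finset.sum_eq_zero fun x hx => by rw [hb' x hx, mul_zero]] at h3
      simpa [hP0] using h3
    · exact hb' lam hlam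

theorem pow_exp_independent {k : ℕ} {S : Finset ℝ} {a : ℕ → ℝ} {b : ℝ → ℝ} (h0 : 0 ∉ S)
    (h : ∀ t : ℝ, ∑ N ∈ Finset.range k, t ^ N * a N
      + ∑ lam ∈ S, Real.exp (lam * t) * b lam = 0) :
    (∀ N < k, a N = 0) ∧ ∀ lam ∈ S, b lam = 0 := by
  obtain ⟨hP, hb⟩ := polynomial_exp_independent S b
    (∑ N ∈ Finset.range k, Polynomial.monomial N (a N)) h0 fun t => by
      rw [← h t, Polynomial.eval_finsetSum]
      congr 1
      exact Finset.sum_congr rfl fun N _ => by rw [Polynomial.eval_monomial, mul_comm]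
  refine ⟨fun N hN => ?_, hb⟩
  have := congrArg (fun p => Polynomial.coeff p N) hP
  simpa [Polynomial.finsetSum_coeff, Polynomial.coeff_monomial, hN] using this

/-! ### Coefficients that combine powers and exponentials of `t`. -/

/-- The coefficients `∑_N t^N A_{(N)} + ∑_λ e^{λt} B_{(λ)}`. -/
def polyExpFamily {d : ℕ} (k : ℕ) (A : ℕ → (r : ℕ) → Field d r) (S : Finset ℝ)
    (B : ℝ → (r : ℕ) → Field d r) : (r : ℕ) → ℝ → Field d r :=
  fun r t q i => ∑ N ∈ Finset.range k, t ^ N * A N r q i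
    + ∑ lam ∈ S, Real.exp (lam * t) * B lam r q i

/-- Smooth symmetric coefficients of a polynomial of degree at most `m` in the velocity. -/
structure IsTensorFamily {d : ℕ} (U : Set (Coord d)) (m : ℕ) (T : (r : ℕ) → Field d r) :
    Prop where
  symm : ∀ r, IsSymmTensor U (T r)
  eq_zero : ∀ r, m < r → T r = 0

theorem IsSymmTensor.differentiableAt {d r : ℕ} {U : Set (Coord d)} (hU : IsOpen U)
    {T : Field d r} (hT : IsSymmTensor U T) {q : Coord d} (hq : q ∈ U) (i : Fin r → Fin d) :
    DifferentiableAt ℝ (fun y => T y i) q :=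
  differentiableAt_pi.1 ((hT.1.contDiffAt (hU.mem_nhds hq)).differentiableAt (by simp)) i

theorem isCoeffFamily_polyExpFamily {d m : ℕ} {U : Set (Coord d)} (hU : IsOpen U) {k : ℕ}
    {A : ℕ → (r : ℕ) → Field d r} {S : Finset ℝ} {B : ℝ → (r : ℕ) → Field d r}
    (hA : ∀ N < k, IsTensorFamily U m (A N)) (hB : ∀ lam ∈ S, IsTensorFamily U m (B lam)) :
    IsCoeffFamily U m (polyExpFamily k A S B) where
  diff r i t q hq := by
    have hc : ∀ {T : Field d r}, IsSymmTensor U T →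
        DifferentiableAt ℝ (fun x : ℝ × Coord d => T x.2 i) (t, q) := fun {T} hT =>
      DifferentiableAt.comp (g := fun y => T y i) (t, q) (hT.differentiableAt hU hq i)
        differentiableAt_snd
    refine DifferentiableAt.add (DifferentiableAt.fun_sum fun N hN => ?_)
      (DifferentiableAt.fun_sum fun lam hlam => ?_)
    · exact (differentiableAt_fst.pow N).mul (hc ((hA N (Finset.mem_range.1 hN)).symm r))
    · exact (differentiableAt_fst.const_mul lam).exp.mul (hc ((hB lam hlam).symm r))
  symm r t q hq σ i := by
    unfold polyExpFamily
    congr 1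
    · exact Finset.sum_congr rfl fun N hN => by
        rw [((hA N (Finset.mem_range.1 hN)).symm r).2 q hq]
    · exact Finset.sum_congr rfl fun lam hlam => by rw [((hB lam hlam).symm r).2 q hq]
  eq_zero r hr := by
    ext t q i
    unfold polyExpFamily
    rw [Finset.sum_eq_zero fun N hN => by
        rw [(hA N (Finset.mem_range.1 hN)).eq_zero r hr]; simp,
      Finset.sum_eq_zero fun lam hlam => by rw [(hB lam hlam).eq_zero r hr]; simp]
    simp

theorem detCoeff_polyExpFamily {d m : ℕ} {U : Set (Coord d)} (hU : IsOpen U) (Γ : Conn d)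
    (Q : Coord d → Coord d) {k : ℕ}
    {A : ℕ → (r : ℕ) → Field d r} {S : Finset ℝ} {B : ℝ → (r : ℕ) → Field d r}
    (hA : ∀ N < k, IsTensorFamily U m (A N)) (hB : ∀ lam ∈ S, IsTensorFamily U m (B lam))
    (t : ℝ) {q : Coord d} (hq : q ∈ U) (r : ℕ) (i : Fin r → Fin d) :
    detCoeff Γ Q (fun r => polyExpFamily k A S B r t) r q i
      = ∑ N ∈ Finset.range k, t ^ N * detCoeff Γ Q (A N) r q i
        + ∑ lam ∈ S, Real.exp (lam * t) * detCoeff Γ Q (B lam) r q i := by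
  -- Both sums are treated as one finite linear combination over the disjoint union of the index
  -- sets.
  have h := detCoeff_sum Γ Q (s := (Finset.range k).disjSum S)
    (c := Sum.elim (fun N => t ^ N) fun lam => Real.exp (lam * t)) (T := Sum.elim A B) (q := q)
    (fun x hx r i => by
      rcases Finset.mem_disjSum.1 hx with ⟨N, hN, rfl⟩ | ⟨lam, hlam, rfl⟩
      · exact ((hA N (Finset.mem_range.1 hN)).symm r).differentiableAt hU hq i
      · exact ((hB lam hlam).symm r).differentiableAt hU hq i) r i
  simp only [Finset.sum_disjSum, Sum.elim_inl, Sum.elim_inr] at h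
  exact h

theorem timeDeriv_polyExpFamily {d k : ℕ} {A : ℕ → (r : ℕ) → Field d r} {S : Finset ℝ}
    {B : ℝ → (r : ℕ) → Field d r} {r : ℕ} (hk : A k r = 0) (t : ℝ) (q : Coord d)
    (i : Fin r → Fin d) :
    timeDeriv (polyExpFamily k A S B) t r q i
      = ∑ N ∈ Finset.range k, t ^ N * (((N : ℝ) + 1) * A (N + 1) r q i)
        + ∑ lam ∈ S, Real.exp (lam * t) * (lam * B lam r q i) := by
  have h1 : HasDerivAt (fun τ => polyExpFamily k A S B r τ q i)
      (∑ N ∈ Finset.range k, ((N : ℝ) * t ^ (N - 1)) * A N r q i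
        + ∑ lam ∈ S, (Real.exp (lam * t) * lam) * B lam r q i) t := by
    refine HasDerivAt.add (HasDerivAt.fun_sum fun N _ => (hasDerivAt_pow N t).mul_const _)
      (HasDerivAt.fun_sum fun lam _ => ?_)
    simpa using (((hasDerivAt_id t).const_mul lam).exp).mul_const (B lam r q i)
  have h2 : ∑ N ∈ Finset.range k, ((N : ℝ) * t ^ (N - 1)) * A N r q i
      = ∑ N ∈ Finset.range k, t ^ N * (((N : ℝ) + 1) * A (N + 1) r q i) := by
    -- Differentiation shifts the powers down by one; the extra top term of the shifted sum is zero
    -- because `A k r = 0`.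
    have h3 := Finset.sum_range_succ (fun N => ((N : ℝ) * t ^ (N - 1)) * A N r q i) k
    rw [Finset.sum_range_succ', hk] at h3
    simp only [Pi.zero_apply, mul_zero, add_zero, Nat.cast_zero, zero_mul] at h3
    rw [← h3]
    refine Finset.sum_congr rfl fun N _ => ?_
    push_cast
    ring
  unfold timeDeriv
  rw [h1.deriv, h2]
  congr 1
  exact Finset.sum_congr rfl fun lam _ => by ring

theorem polyExpFamily_det_eq {d m : ℕ} {U : Set (Coord d)} (hU : IsOpen U) (Γ : Conn d)
    (Q : Coord d → Coord d) {k : ℕ}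
    {A : ℕ → (r : ℕ) → Field d r} {S : Finset ℝ} {B : ℝ → (r : ℕ) → Field d r}
    (hA : ∀ N < k, IsTensorFamily U m (A N)) (hB : ∀ lam ∈ S, IsTensorFamily U m (B lam))
    (hk : A k = 0) (t : ℝ) {q : Coord d} (hq : q ∈ U) (r : ℕ) (i : Fin r → Fin d) :
    timeDeriv (polyExpFamily k A S B) t r q i
        + detCoeff Γ Q (fun r => polyExpFamily k A S B r t) r q i
      = ∑ N ∈ Finset.range k,
          t ^ N * (((N : ℝ) + 1) * A (N + 1) r q i + detCoeff Γ Q (A N) r q i)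
        + ∑ lam ∈ S, Real.exp (lam * t) * (lam * B lam r q i + detCoeff Γ Q (B lam) r q i) := by
  rw [timeDeriv_polyExpFamily (by rw [hk]; rfl), detCoeff_polyExpFamily hU Γ Q hA hB t hq]
  simp only [mul_add, Finset.sum_add_distrib]
  ring

theorem det_eq_zero_of_isFirstIntegral {d m : ℕ} {U : Set (Coord d)} (hU : IsOpen U) {Γ : Conn d}
    (hΓ : ContDiffOn ℝ (⊤ : ℕ∞) Γ U) {Q : Coord d → Coord d} (hQ : ContDiffOn ℝ (⊤ : ℕ∞) Q U)
    {k : ℕ} {A : ℕ → (r : ℕ) → Field d r} {S : Finset ℝ} {B : ℝ → (r : ℕ) → Field d r}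
    (h0 : 0 ∉ S)
    (hA : ∀ N < k, IsTensorFamily U m (A N)) (hB : ∀ lam ∈ S, IsTensorFamily U m (B lam))
    (hk : A k = 0) (hI : IsFirstIntegral U Γ Q (coeffSum m (polyExpFamily k A S B)))
    {q : Coord d} (hq : q ∈ U) {r : ℕ} (hr : r < m + 2) (i : Fin r → Fin d) :
    (∀ N < k, ((N : ℝ) + 1) * A (N + 1) r q i + detCoeff Γ Q (A N) r q i = 0) ∧
      ∀ lam ∈ S, lam * B lam r q i + detCoeff Γ Q (B lam) r q i = 0 :=
  pow_exp_independent h0 fun t => by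
    rw [← polyExpFamily_det_eq hU Γ Q hA hB hk t hq]
    exact timeDeriv_add_detCoeff_eq_zero hU hΓ hQ (isCoeffFamily_polyExpFamily hU hA hB) hI t hq
      hr i

theorem isFirstIntegral_polyExpFamily {d m : ℕ} {U : Set (Coord d)} (hU : IsOpen U) {Γ : Conn d}
    {Q : Coord d → Coord d}
    {k : ℕ} {A : ℕ → (r : ℕ) → Field d r} {S : Finset ℝ} {B : ℝ → (r : ℕ) → Field d r}
    (hA : ∀ N < k, IsTensorFamily U m (A N)) (hB : ∀ lam ∈ S, IsTensorFamily U m (B lam))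
    (hk : A k = 0)
    (hA' : ∀ N < k, ∀ r < m + 2, ∀ q ∈ U, ∀ i : Fin r → Fin d,
      ((N : ℝ) + 1) * A (N + 1) r q i + detCoeff Γ Q (A N) r q i = 0)
    (hB' : ∀ lam ∈ S, ∀ r < m + 2, ∀ q ∈ U, ∀ i : Fin r → Fin d,
      lam * B lam r q i + detCoeff Γ Q (B lam) r q i = 0) :
    IsFirstIntegral U Γ Q (coeffSum m (polyExpFamily k A S B)) := by
  refine isFirstIntegral_coeffSum (isCoeffFamily_polyExpFamily hU hA hB) fun t q hq r hr i => ?_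
  rw [polyExpFamily_det_eq hU Γ Q hA hB hk t hq,
    Finset.sum_eq_zero fun N hN => by rw [hA' N (Finset.mem_range.1 hN) r hr q hq, mul_zero],
    Finset.sum_eq_zero fun lam hlam => by rw [hB' lam hlam r hr q hq, mul_zero], add_zero]

/-! ### Locality on `U` and elementary rules. -/

theorem pderiv_congr {d : ℕ} {U : Set (Coord d)} (hU : IsOpen U) {f g : Coord d → ℝ}
    (h : ∀ q ∈ U, f q = g q) {q : Coord d} (hq : q ∈ U) (k : Fin d) :
    pderiv f q k = pderiv g q k := by
  unfold pderiv
  rw [Filter.EventuallyEq.fderiv_eq (Filter.eventually_of_mem (hU.mem_nhds hq) h)]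

theorem symCov_congr {d r : ℕ} {U : Set (Coord d)} (hU : IsOpen U) (Γ : Conn d) {S T : Field d r}
    (h : ∀ q ∈ U, ∀ i, S q i = T q i) {q : Coord d} (hq : q ∈ U) (i : Fin (r + 1) → Fin d) :
    symCov Γ S q i = symCov Γ T q i := by
  unfold symCov covDeriv
  congr 1
  refine Finset.sum_congr rfl fun σ _ => ?_
  rw [pderiv_congr hU (fun x hx => h x hx _) hq]
  simp only [h q hq]

theorem symCov_const_mul {d r : ℕ} (Γ : Conn d) (c : ℝ) {T : Field d r} {q : Coord d}
    (hT : ∀ i, DifferentiableAt ℝ (fun y => T y i) q) (i : Fin (r + 1) → Fin d) :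
    symCov Γ (fun y i => c * T y i) q i = c * symCov Γ T q i := by
  simpa using symCov_sum Γ (Finset.univ : Finset Unit) (fun _ => c) (T := fun _ => T)
    (fun _ _ => hT) i

theorem symCov_zero {d r : ℕ} (Γ : Conn d) : symCov Γ (0 : Field d r) = 0 := by
  ext q i
  have h := symCov_sum Γ (∅ : Finset Unit) (fun _ => 0) (T := fun _ => (0 : Field d r)) (q := q)
    (by simp) i
  simp only [Finset.sum_empty] at h
  exact h

theorem symCov_rank_zero {d : ℕ} (Γ : Conn d) (T : Field d 0) (q : Coord d) (i : Fin 1 → Fin d)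
    (j : Fin 0 → Fin d) : symCov Γ T q i = pderiv (fun x => T x j) q (i 0) := by
  simp [symCov, covDeriv, Subsingleton.elim _ j]

theorem contr_congr {d r : ℕ} {S T : Field d (r + 1)} (Q : Coord d → Coord d) {q : Coord d}
    (h : ∀ i, S q i = T q i) (i : Fin r → Fin d) : contr S Q q i = contr T Q q i := by
  simp only [contr, h]

theorem contr_const_mul {d r : ℕ} (Q : Coord d → Coord d) (c : ℝ) (T : Field d (r + 1))
    (q : Coord d) (i : Fin r → Fin d) :
    contr (fun y i => c * T y i) Q q i = c * contr T Q q i := by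
  simpa using contr_sum Q (Finset.univ : Finset Unit) (fun _ => c) (fun _ => T) q i

theorem contr_rank_one {d : ℕ} (L : Field d 1) (Q : Coord d → Coord d) (q : Coord d)
    (i : Fin 0 → Fin d) : contr L Q q i = pairing L Q q := by
  unfold contr pairing
  refine Finset.sum_congr rfl fun c _ => ?_
  congr 2

theorem evalVel_rank_zero {d : ℕ} (T : (Fin 0 → Fin d) → ℝ) (v : Coord d) (i : Fin 0 → Fin d) :
    evalVel T v = T i := by
  simp [evalVel, Subsingleton.elim _ i]

theorem IsSymmTensor.congr {d r : ℕ} {U : Set (Coord d)} {S T : Field d r}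
    (hT : IsSymmTensor U T) (h : ∀ q ∈ U, ∀ i, S q i = T q i) : IsSymmTensor U S :=
  ⟨hT.1.congr fun q hq => funext fun i => h q hq i, fun q hq σ i => by
    rw [h q hq, h q hq, hT.2 q hq]⟩

theorem IsSymmTensor.const_mul {d r : ℕ} {U : Set (Coord d)} {T : Field d r}
    (hT : IsSymmTensor U T) (c : ℝ) : IsSymmTensor U (fun q i => c * T q i) :=
  ⟨contDiffOn_pi.2 fun i => contDiffOn_const.mul (contDiffOn_pi.1 hT.1 i), fun q hq σ i => by
    simp only [hT.2 q hq]⟩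

theorem isSymmTensor_zero {d r : ℕ} (U : Set (Coord d)) : IsSymmTensor U (0 : Field d r) :=
  ⟨contDiffOn_const, fun _ _ _ _ => rfl⟩

theorem isSymmTensor_rank_zero {d : ℕ} {U : Set (Coord d)} {T : Field d 0}
    (h : ∀ i, ContDiffOn ℝ (⊤ : ℕ∞) (fun q => T q i) U) : IsSymmTensor U T :=
  ⟨contDiffOn_pi.2 h, fun q _ σ i => by rw [Subsingleton.elim (i ∘ σ) i]⟩

theorem contDiffOn_pairing {d : ℕ} {U : Set (Coord d)} {L : Field d 1} (hL : IsSymmTensor U L)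
    {Q : Coord d → Coord d} (hQ : ContDiffOn ℝ (⊤ : ℕ∞) Q U) :
    ContDiffOn ℝ (⊤ : ℕ∞) (pairing L Q) U :=
  ContDiffOn.sum fun c _ => (contDiffOn_pi.1 hL.1 _).mul (contDiffOn_pi.1 hQ c)

theorem pderiv_const {d : ℕ} (c : ℝ) (q : Coord d) (k : Fin d) :
    pderiv (fun _ => c) q k = 0 := by
  simp [pderiv]

theorem pderiv_div_const {d : ℕ} {f : Coord d → ℝ} {q : Coord d} (c : ℝ) (k : Fin d) :
    pderiv (fun x => f x / c) q k = pderiv f q k / c := by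
  unfold pderiv
  simp only [div_eq_inv_mul]
  have : (fun x => c⁻¹ * f x) = c⁻¹ • f := rfl
  rw [this, fderiv_const_smul_field]
  rfl

theorem exists_eq_const_of_pderiv_eq_zero {d : ℕ} {U : Set (Coord d)} (hU : IsOpen U)
    (hUc : IsPreconnected U) {f : Coord d → ℝ} (hf : ∀ q ∈ U, DifferentiableAt ℝ f q)
    (h : ∀ q ∈ U, ∀ k, pderiv f q k = 0) : ∃ s, ∀ q ∈ U, f q = s := by
  refine hU.exists_is_const_of_fderiv_eq_zero hUc
    (fun q hq => (hf q hq).differentiableWithinAt) fun q hq => ?_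
  ext v
  have := LinearMap.pi_apply_eq_sum_univ (fderiv ℝ f q).toLinearMap v
  simp only [ContinuousLinearMap.coe_coe] at this
  rw [this]
  refine Finset.sum_eq_zero fun k _ => ?_
  have h2 : (fun j => if k = j then (1 : ℝ) else 0) = Pi.single k 1 := by
    ext j
    simp [Pi.single_apply, eq_comm]
  rw [h2]
  have := h q hq k
  unfold pderiv at this
  rw [this, smul_zero]

theorem sum_Icc_one {k : ℕ} (f : ℕ → ℝ) :
    ∑ N ∈ Finset.Icc 1 k, f N = ∑ N ∈ Finset.range k, f (N + 1) := by
  rw [← Finset.Ico_add_one_right_eq_Icc, Finset.sum_Ico_eq_sum_range, Nat.add_sub_cancel]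
  exact Finset.sum_congr rfl fun N _ => by rw [add_comm]

/-! ### Assembling a family from its members of lowest, middle and highest rank. -/

/-- The family with the given members of rank `0` and `p + 2`, with `L r` for `1 ≤ r ≤ p + 1`, and
with `0` in higher rank. -/
def assemble {d : ℕ} (p : ℕ) (T₀ : Field d 0) (L : (r : ℕ) → Field d r) (T : Field d (p + 2)) :
    (r : ℕ) → Field d r
  | 0 => T₀
  | r + 1 => if r + 1 ≤ p + 1 then L (r + 1) else if h : p + 2 = r + 1 then h ▸ T else 0

section assemble

variable {d p : ℕ} (T₀ : Field d 0) (L : (r : ℕ) → Field d r) (T : Field d (p + 2))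

theorem assemble_zero : assemble p T₀ L T 0 = T₀ := rfl

theorem assemble_mid {r : ℕ} (h1 : 1 ≤ r) (h2 : r ≤ p + 1) : assemble p T₀ L T r = L r := by
  obtain ⟨r, rfl⟩ := Nat.exists_eq_add_of_le' h1
  simp [assemble, Nat.le_of_succ_le_succ h2]

theorem assemble_top : assemble p T₀ L T (p + 2) = T := by
  simp [assemble]

theorem assemble_above {r : ℕ} (h : p + 2 < r) : assemble p T₀ L T r = 0 := by
  obtain ⟨r, rfl⟩ := Nat.exists_eq_add_of_le' (show 1 ≤ r by omega)
  simp only [assemble]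
  rw [if_neg (by omega), dif_neg (by omega)]

theorem isTensorFamily_assemble {U : Set (Coord d)} (h0 : IsSymmTensor U T₀)
    (hL : ∀ r, 1 ≤ r → r ≤ p + 1 → IsSymmTensor U (L r)) (hT : IsSymmTensor U T) :
    IsTensorFamily U (p + 2) (assemble p T₀ L T) where
  symm r := by
    rcases Nat.eq_zero_or_pos r with rfl | h1
    · exact h0
    rcases le_or_gt r (p + 1) with h2 | h2
    · rw [assemble_mid _ _ _ h1 h2]
      exact hL r h1 h2
    rcases (show p + 2 ≤ r from h2).eq_or_lt with rfl | h3
    · rw [assemble_top]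
      exact hT
    · rw [assemble_above _ _ _ h3]
      exact isSymmTensor_zero U
  eq_zero r hr := assemble_above _ _ _ hr

end assemble

/-! ### Integrals of exponential type. -/

/-- `L` and the rank `p + 2` and rank `0` coefficients built from it are the members of `B`. -/
structure IsExpRepr {d : ℕ} (p : ℕ) (U : Set (Coord d)) (Γ : Conn d) (Q : Coord d → Coord d)
    (lam : ℝ) (L B : (r : ℕ) → Field d r) : Prop where
  mid : ∀ r, 1 ≤ r → r ≤ p + 1 → B r = L r
  top : ∀ q ∈ U, ∀ i, B (p + 2) q i = -(1 / lam) * symCov Γ (L (p + 1)) q i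
  base : ∀ q ∈ U, ∀ i, B 0 q i = pairing (L 1) Q q / lam
  above : ∀ r, p + 2 < r → B r = 0

section

variable {d p : ℕ} {U : Set (Coord d)} {Γ : Conn d} {Q : Coord d → Coord d} {lam : ℝ}
  {L B : (r : ℕ) → Field d r}

theorem IsExpRepr.sum_eq (h : IsExpRepr p U Γ Q lam L B) (hlam : lam ≠ 0) (t : ℝ) {q : Coord d}
    (hq : q ∈ U) (v : Coord d) :
    ∑ r ∈ Finset.range (p + 3), evalVel (fun i => Real.exp (lam * t) * B r q i) v
      = integralExp p Γ Q lam L t q v := by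
  rw [Finset.sum_range_succ, Finset.sum_range_succ']
  have h1 : evalVel (fun i => Real.exp (lam * t) * B (p + 2) q i) v
      = Real.exp (lam * t) * (-(1 / lam) * evalVel (symCov Γ (L (p + 1)) q) v) := by
    simp only [h.top q hq]
    rw [evalVel_mul, evalVel_mul]
  have h2 : ∑ r ∈ Finset.range (p + 1), evalVel (fun i => Real.exp (lam * t) * B (r + 1) q i) v
      = Real.exp (lam * t) * ∑ r ∈ Finset.range (p + 1), evalVel (L (r + 1) q) v := by
    rw [Finset.mul_sum]
    refine Finset.sum_congr rfl fun r hr => ?_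
    have := Finset.mem_range.1 hr
    rw [h.mid (r + 1) (by omega) (by omega), evalVel_mul]
  rw [h1, h2, evalVel_rank_zero _ _ Fin.elim0, h.base q hq, integralExp, sum_Icc_one]
  field_simp
  ring

theorem IsExpRepr.contr_top (h : IsExpRepr p U Γ Q lam L B) {q : Coord d} (hq : q ∈ U)
    (i : Fin (p + 1) → Fin d) :
    contr (B (p + 2)) Q q i = -(1 / lam) * contr (symCov Γ (L (p + 1))) Q q i := by
  rw [← contr_const_mul]
  exact contr_congr (r := p + 1) Q (h.top q hq) i

theorem IsExpRepr.contr_rank_two (h : IsExpRepr p U Γ Q lam L B) {q : Coord d} (hq : q ∈ U)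
    (i : Fin 1 → Fin d) : contr (B 2) Q q i = contr (rankTwoExp Γ lam p L) Q q i := by
  cases p with
  | zero => exact contr_congr Q (h.top q hq) i
  | succ p => rw [h.mid 2 (by omega) (by omega), rankTwoExp]

theorem IsExpRepr.symCov_rank_zero (h : IsExpRepr p U Γ Q lam L B) (hU : IsOpen U) {q : Coord d}
    (hq : q ∈ U) (i : Fin 1 → Fin d) :
    symCov Γ (B 0) q i = pderiv (pairing (L 1) Q) q (i 0) / lam := by
  rw [FirstIntegrals.symCov_rank_zero Γ _ q i Fin.elim0, pderiv_congr hU (fun x hx => h.base x hx _) hq,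
    pderiv_div_const]

theorem IsExpRepr.det_eq_zero (h : IsExpRepr p U Γ Q lam L B) (hU : IsOpen U) (hlam : lam ≠ 0)
    (hL : IsExpData p U Γ Q lam L) {r : ℕ} (hr : r < p + 4) {q : Coord d} (hq : q ∈ U)
    (i : Fin r → Fin d) : lam * B r q i + detCoeff Γ Q B r q i = 0 := by
  obtain rfl | ⟨l, rfl⟩ : r = 0 ∨ ∃ l, r = l + 1 :=
    (Nat.eq_zero_or_pos r).imp_right fun h => Nat.exists_eq_add_of_le' h
  · rw [detCoeff_zero, h.mid 1 le_rfl (by omega), contr_rank_one, h.base q hq]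
    field_simp
    ring
  rw [detCoeff_succ]
  obtain rfl | hl0 := Nat.eq_zero_or_pos l
  · rw [h.contr_rank_two hq, h.symCov_rank_zero hU hq, h.mid (0 + 1) le_rfl (by omega),
      hL.cond_c q hq, show i = fun _ => i 0 from funext fun x => by rw [Fin.fin_one_eq_zero x]]
    field_simp
    push_cast
    ring
  -- With `m = p + 2`, the ranks `2,…,m-2` use `cond_b`, rank `m-1` uses `cond_a`, rank `m` is the
  -- formula for the highest coefficient, and rank `m+1` is its Killing equation.
  obtain hl1 | rfl | rfl | rfl : l + 1 ≤ p ∨ l = p ∨ l = p + 1 ∨ l = p + 2 := by omega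
  · rw [h.mid l hl0 (by omega), h.mid (l + 1) (by omega) (by omega),
      h.mid (l + 2) (by omega) (by omega), hL.cond_b l hl0 hl1 q hq]
    ring
  · rw [h.mid l hl0 (by omega), h.mid (l + 1) (by omega) (by omega), h.contr_top hq,
      hL.cond_a hl0 q hq]
    field_simp
    ring
  · rw [h.mid (p + 1) (by omega) le_rfl, h.above (p + 1 + 2) (by omega), contr_zero, h.top q hq]
    simp only [Pi.zero_apply]
    field_simp
    ring
  · rw [h.above (p + 2 + 1) (by omega), h.above (p + 2 + 2) (by omega), contr_zero,
      symCov_congr hU Γ h.top hq,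
      symCov_const_mul Γ _ fun j => hL.L_killing.1.differentiableAt hU hq j,
      hL.L_killing.2 q hq]
    simp

theorem isExpRepr_assemble (p : ℕ) (U : Set (Coord d)) (Γ : Conn d) (Q : Coord d → Coord d)
    (lam : ℝ) (L : (r : ℕ) → Field d r) :
    IsExpRepr p U Γ Q lam L (assemble p (fun q _ => pairing (L 1) Q q / lam) L
      (fun q i => -(1 / lam) * symCov Γ (L (p + 1)) q i)) where
  mid r h1 h2 := assemble_mid _ _ _ h1 h2
  top q _ i := by rw [assemble_top]
  base q _ i := rfl
  above r hr := assemble_above _ _ _ hr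

theorem isFirstIntegral_integralExp (hU : IsOpen U) (hQ : ContDiffOn ℝ (⊤ : ℕ∞) Q U)
    (hlam : lam ≠ 0) (hL : IsExpData p U Γ Q lam L) :
    IsFirstIntegral U Γ Q (integralExp p Γ Q lam L) := by
  have hrep := isExpRepr_assemble p U Γ Q lam L
  have hfam := isTensorFamily_assemble _ _ _
    (isSymmTensor_rank_zero (T := fun q _ => pairing (L 1) Q q / lam) fun _ =>
      (contDiffOn_pairing (hL.L_symm 1 le_rfl (by omega)) hQ).div_const lam)
    hL.L_symm (hL.L_killing.1.const_mul (-(1 / lam)))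
  refine (isFirstIntegral_polyExpFamily (k := 0) (A := 0) (S := {lam})
    (B := fun _ => _) hU (by simp) (fun _ _ => hfam) rfl (by simp) ?_).congr
    (fun t q hq v => Eq.trans ?_ (hrep.sum_eq hlam t hq v))
  · intro mu hmu r hr q hq i
    rw [Finset.mem_singleton.1 hmu]
    exact hrep.det_eq_zero hU hlam hL hr hq i
  · unfold coeffSum
    refine Finset.sum_congr rfl fun r _ => congrArg (evalVel · v) (funext fun i => ?_)
    simp only [polyExpFamily, Finset.range_zero, Finset.sum_empty, zero_add,
      Finset.sum_singleton]

/-- A family of tensors that satisfies the determining equations of `e^{λt} B` is a datum of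
exponential type. -/
theorem isExpRepr_of_det_eq_zero (hlam : lam ≠ 0) (hB : IsTensorFamily U (p + 2) B)
    (h : ∀ q ∈ U, ∀ r < p + 4, ∀ i : Fin r → Fin d, lam * B r q i + detCoeff Γ Q B r q i = 0) :
    IsExpRepr p U Γ Q lam B B where
  mid _ _ _ := rfl
  top q hq i := by
    have := h q hq (p + 2) (by omega) i
    rw [detCoeff_succ, hB.eq_zero (p + 1 + 2) (by omega), contr_zero] at this
    simp only [Pi.zero_apply] at this
    field_simp
    linear_combination this
  base q hq i := by
    have := h q hq 0 (by omega) i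
    rw [detCoeff_zero, contr_rank_one] at this
    field_simp
    linear_combination this
  above := hB.eq_zero

theorem isExpData_of_det_eq_zero (hU : IsOpen U) (hlam : lam ≠ 0)
    (hB : IsTensorFamily U (p + 2) B)
    (h : ∀ q ∈ U, ∀ r < p + 4, ∀ i : Fin r → Fin d, lam * B r q i + detCoeff Γ Q B r q i = 0) :
    IsExpData p U Γ Q lam B := by
  have hrep := isExpRepr_of_det_eq_zero hlam hB h
  -- The rank `m` equation, solved for the covariant derivative: a multiple of a smooth symmetric
  -- tensor, whose Killing property is the rank `m+1` equation.
  have htop : ∀ q ∈ U, ∀ i, symCov Γ (B (p + 1)) q i = -lam * B (p + 2) q i := fun q hq i => by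
    rw [hrep.top q hq]
    field_simp
  refine
    { L_symm := fun r _ _ => hB.symm r
      L_killing := ⟨((hB.symm (p + 2)).const_mul (-lam)).congr htop, fun q hq i => ?_⟩
      cond_a := fun hp q hq i => ?_
      cond_b := fun l hl hlp q hq i => ?_
      cond_c := fun q hq a => ?_ }
  · have := h q hq (p + 3) (by omega) i
    rw [detCoeff_succ, hB.eq_zero (p + 2 + 1) (by omega), hB.eq_zero (p + 2 + 2) (by omega),
      contr_zero] at this
    rw [symCov_congr hU Γ htop hq,
      symCov_const_mul Γ _ fun j => (hB.symm (p + 2)).differentiableAt hU hq j]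
    simp only [Pi.zero_apply] at this
    linear_combination (-lam) * this
  · have := h q hq (p + 1) (by omega) i
    rw [detCoeff_succ, hrep.contr_top hq] at this
    rw [eq_sub_iff_add_eq, ← sub_eq_zero, ← this]
    field_simp
    ring
  · have := h q hq (l + 1) (by omega) i
    rw [detCoeff_succ] at this
    linear_combination this
  · have := h q hq 1 (by omega) fun _ => a
    rw [detCoeff_succ, hrep.contr_rank_two hq, hrep.symCov_rank_zero hU hq] at this
    field_simp at this
    push_cast at this
    linear_combination this

end

/-! ### Integrals of polynomial type. -/

/-- `C`, `L`, `G` and the rank `p + 2` and rank `0` coefficients built from them are the members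
of `A`. -/
structure IsPolyRepr {d p : ℕ} (U : Set (Coord d)) (Γ : Conn d) (Q : Coord d → Coord d)
    (n : ℕ) (C : Field d (p + 2)) (L : ℕ → (r : ℕ) → Field d r) (G : Coord d → ℝ)
    (A : ℕ → (r : ℕ) → Field d r) : Prop where
  mid : ∀ N r, 1 ≤ r → r ≤ p + 1 → A N r = L N r
  top : ∀ N ≤ n, ∀ q ∈ U, ∀ i, A N (p + 2) q i = topCoeff Γ C L N q i
  top_beyond : ∀ N, n < N → A N (p + 2) = 0
  base : ∀ q ∈ U, ∀ i, A 0 0 q i = G q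
  base_succ : ∀ N ≤ n, ∀ q ∈ U, ∀ i, A (N + 1) 0 q i = pairing (L N 1) Q q / ((N : ℝ) + 1)
  above : ∀ N r, p + 2 < r → A N r = 0
  beyond : ∀ N, n + 1 < N → A N = 0
  L_beyond : ∀ N r, n < N → L N r = 0

section

variable {d p n : ℕ} {U : Set (Coord d)} {Γ : Conn d} {Q : Coord d → Coord d}
  {C : Field d (p + 2)} {L : ℕ → (r : ℕ) → Field d r} {s : ℝ} {G : Coord d → ℝ}
  {A : ℕ → (r : ℕ) → Field d r}

theorem topCoeff_zero (q : Coord d) (i : Fin (p + 2) → Fin d) : topCoeff Γ C L 0 q i = C q i := by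
  simp [topCoeff]

theorem topCoeff_succ (N : ℕ) (q : Coord d) (i : Fin (p + 2) → Fin d) :
    topCoeff Γ C L (N + 1) q i = -(1 / ((N : ℝ) + 1)) * symCov Γ (L N (p + 1)) q i := by
  simp [topCoeff]

theorem contr_topCoeff_zero (q : Coord d) (i : Fin (p + 1) → Fin d) :
    contr (topCoeff Γ C L 0) Q q i = contr C Q q i :=
  contr_congr (r := p + 1) Q (topCoeff_zero q) i

theorem contr_topCoeff_succ (N : ℕ) (q : Coord d) (i : Fin (p + 1) → Fin d) :
    contr (topCoeff Γ C L (N + 1)) Q q i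
      = -(1 / ((N : ℝ) + 1)) * contr (symCov Γ (L N (p + 1))) Q q i := by
  rw [← contr_const_mul]
  exact contr_congr (r := p + 1) Q (topCoeff_succ N q) i

namespace IsPolyRepr

theorem sum_eq (h : IsPolyRepr U Γ Q n C L G A) (hs : ∀ q ∈ U, pairing (L n 1) Q q = s) (t : ℝ)
    {q : Coord d} (hq : q ∈ U) (v : Coord d) :
    ∑ r ∈ Finset.range (p + 3), evalVel (fun i => ∑ N ∈ Finset.range (n + 2), t ^ N * A N r q i) v
      = integralPoly Γ Q n C L s G t q v := by
  rw [Finset.sum_range_succ, Finset.sum_range_succ', integralPoly, sum_Icc_one, sum_Icc_one]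
  have h1 : evalVel (fun i => ∑ N ∈ Finset.range (n + 2), t ^ N * A N (p + 2) q i) v
      = evalVel (fun i => -(∑ N ∈ Finset.Icc 1 n, t ^ N / N * symCov Γ (L (N - 1) (p + 1)) q i)
        + C q i) v := by
    congr 1
    funext i
    rw [Finset.sum_range_succ, h.top_beyond (n + 1) (Nat.lt_succ_self n), Finset.sum_range_succ',
      sum_Icc_one, h.top 0 (Nat.zero_le n) q hq, topCoeff_zero, ← Finset.sum_neg_distrib]
    simp only [Pi.zero_apply, mul_zero, add_zero, pow_zero, one_mul, Nat.add_sub_cancel]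
    congr 1
    refine Finset.sum_congr rfl fun N hN => ?_
    rw [h.top (N + 1) (Finset.mem_range.1 hN) q hq, topCoeff_succ]
    push_cast
    ring
  have h2 : ∀ r ∈ Finset.range (p + 1),
      evalVel (fun i => ∑ N ∈ Finset.range (n + 2), t ^ N * A N (r + 1) q i) v
        = evalVel (fun i => ∑ N ∈ Finset.range (n + 1), t ^ N * L N (r + 1) q i) v := by
    intro r hr
    congr 1
    funext i
    have hr' := Finset.mem_range.1 hr
    simp only [fun N => h.mid N (r + 1) (by omega) (by omega)]
    rw [Finset.sum_range_succ, h.L_beyond (n + 1) _ (Nat.lt_succ_self n)]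
    simp
  -- The scalar part has degree `n + 1`, one more than the others; its leading coefficient is
  -- `L_{(n)c} Q^c / (n + 1) = s / (n + 1)`.
  have h3 : evalVel (fun i => ∑ N ∈ Finset.range (n + 2), t ^ N * A N 0 q i) v
      = s * (t ^ (n + 1) / ((n : ℝ) + 1))
        + ∑ N ∈ Finset.range n, pairing (L N 1) Q q * (t ^ (N + 1) / ((N : ℝ) + 1)) + G q := by
    rw [evalVel_rank_zero _ _ Fin.elim0, Finset.sum_range_succ', Finset.sum_range_succ,
      h.base q hq, h.base_succ n le_rfl q hq, hs q hq]
    have : ∑ N ∈ Finset.range n, t ^ (N + 1) * A (N + 1) 0 q Fin.elim0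
        = ∑ N ∈ Finset.range n, pairing (L N 1) Q q * (t ^ (N + 1) / ((N : ℝ) + 1)) :=
      Finset.sum_congr rfl fun N hN => by
        rw [h.base_succ N (Finset.mem_range.1 hN).le q hq]
        ring
    rw [this]
    ring
  rw [h1, Finset.sum_congr rfl h2, h3]
  simp only [Nat.add_sub_cancel]
  push_cast
  ring

theorem contr_top (h : IsPolyRepr U Γ Q n C L G A) {N : ℕ} (hN : N ≤ n) {q : Coord d} (hq : q ∈ U)
    (i : Fin (p + 1) → Fin d) : contr (A N (p + 2)) Q q i = contr (topCoeff Γ C L N) Q q i :=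
  contr_congr (r := p + 1) Q (h.top N hN q hq) i

theorem contr_rank_two (h : IsPolyRepr U Γ Q n C L G A) {N : ℕ} (hN : N ≤ n) {q : Coord d}
    (hq : q ∈ U) (i : Fin 1 → Fin d) :
    contr (A N 2) Q q i = contr (rankTwo Γ p C L N) Q q i := by
  cases p with
  | zero => exact contr_congr Q (h.top N hN q hq) i
  | succ p => rw [h.mid N 2 (by omega) (by omega), rankTwo]

theorem symCov_base (h : IsPolyRepr U Γ Q n C L G A) (hU : IsOpen U) {q : Coord d} (hq : q ∈ U)
    (i : Fin 1 → Fin d) : symCov Γ (A 0 0) q i = pderiv G q (i 0) := by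
  rw [symCov_rank_zero Γ _ q i Fin.elim0, pderiv_congr hU (fun x hx => h.base x hx _) hq]

theorem symCov_base_succ (h : IsPolyRepr U Γ Q n C L G A) (hU : IsOpen U) {N : ℕ} (hN : N ≤ n)
    {q : Coord d} (hq : q ∈ U) (i : Fin 1 → Fin d) :
    symCov Γ (A (N + 1) 0) q i = pderiv (pairing (L N 1) Q) q (i 0) / ((N : ℝ) + 1) := by
  rw [symCov_rank_zero Γ _ q i Fin.elim0, pderiv_congr hU (fun x hx => h.base_succ N hN x hx _) hq,
    pderiv_div_const]

theorem eq_zero_beyond (h : IsPolyRepr U Γ Q n C L G A) {N r : ℕ} (hN : n < N) (hr : 1 ≤ r) :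
    A N r = 0 := by
  rcases le_or_gt r (p + 1) with h1 | h1
  · rw [h.mid N r hr h1, h.L_beyond N r hN]
  rcases (show p + 2 ≤ r from h1).eq_or_lt with rfl | h2
  · exact h.top_beyond N hN
  · exact h.above N r h2

/-- At `t^{n+1}` only the scalar coefficient `s / (n + 1)` is left, and its gradient is zero. -/
theorem det_eq_zero_beyond (h : IsPolyRepr U Γ Q n C L G A) (hU : IsOpen U)
    (hs : ∀ q ∈ U, pairing (L n 1) Q q = s) {r : ℕ}
    {q : Coord d} (hq : q ∈ U) (i : Fin r → Fin d) :
    (((n + 1 : ℕ) : ℝ) + 1) * A (n + 1 + 1) r q i + detCoeff Γ Q (A (n + 1)) r q i = 0 := by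
  rw [h.beyond (n + 1 + 1) (by omega)]
  simp only [Pi.zero_apply, mul_zero, zero_add]
  match r with
  | 0 =>
    rw [detCoeff_zero, h.eq_zero_beyond (Nat.lt_succ_self n) le_rfl, contr_zero]
    simp
  | 1 =>
    rw [detCoeff_succ, h.eq_zero_beyond (r := 0 + 2) (Nat.lt_succ_self n) (by omega), contr_zero,
      h.symCov_base_succ hU le_rfl hq, pderiv_congr hU hs hq, pderiv_const]
    simp
  | r + 2 =>
    rw [detCoeff_succ, h.eq_zero_beyond (Nat.lt_succ_self n) (by omega),
      h.eq_zero_beyond (Nat.lt_succ_self n) (by omega), contr_zero, symCov_zero]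
    simp

theorem det_eq_zero (h : IsPolyRepr U Γ Q n C L G A) (hU : IsOpen U)
    (hD : IsPolyData U Γ Q n C L s G) {N r : ℕ} (hN : N < n + 2) (hr : r < p + 4)
    {q : Coord d} (hq : q ∈ U) (i : Fin r → Fin d) :
    ((N : ℝ) + 1) * A (N + 1) r q i + detCoeff Γ Q (A N) r q i = 0 := by
  obtain rfl | hN : N = n + 1 ∨ N ≤ n := by omega
  · exact h.det_eq_zero_beyond hU hD.s_eq hq i
  have hN0 : (N : ℝ) + 1 ≠ 0 := by positivity
  obtain rfl | ⟨l, rfl⟩ : r = 0 ∨ ∃ l, r = l + 1 :=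
    (Nat.eq_zero_or_pos r).imp_right fun h => Nat.exists_eq_add_of_le' h
  · rw [detCoeff_zero, h.mid N 1 le_rfl (by omega), contr_rank_one, h.base_succ N hN q hq]
    field_simp
    ring
  rw [detCoeff_succ]
  obtain rfl | hl0 := Nat.eq_zero_or_pos l
  · rw [h.contr_rank_two hN hq, h.mid (N + 1) (0 + 1) le_rfl (by omega),
      show i = fun _ => i 0 from funext fun x => by rw [Fin.fin_one_eq_zero x]]
    cases N with
    | zero =>
      rw [h.symCov_base hU hq, hD.cond_i q hq]
      push_cast
      ring
    | succ N =>
      rw [h.symCov_base_succ hU (by omega) hq]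
      -- The top power `N = n` has its own condition because `L_{(n+1)} = 0`; the same distinction
      -- recurs in the higher ranks.
      rcases hN.eq_or_lt with rfl | hlt
      · have hg := hD.cond_g (by omega) q hq (i 0)
        rw [Nat.add_sub_cancel] at hg
        rw [hg, hD.L_beyond _ _ (Nat.lt_succ_self _)]
        simp only [Pi.zero_apply]
        push_cast
        field_simp
        ring
      · have hg := hD.cond_h (N + 2) (by omega) hlt q hq (i 0)
        rw [Nat.add_sub_cancel, show N + 2 - 1 = N + 1 from rfl] at hg
        rw [hg]
        push_cast
        field_simp
        ring
  obtain hl1 | rfl | rfl | rfl : l + 1 ≤ p ∨ p = l ∨ l = p + 1 ∨ l = p + 2 := by omega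
  · rw [h.mid N l hl0 (by omega), h.mid (N + 1) (l + 1) (by omega) (by omega),
      h.mid N (l + 2) (by omega) (by omega)]
    rcases hN.eq_or_lt with rfl | hlt
    · rw [hD.cond_d l hl0 hl1 q hq, hD.L_beyond _ _ (Nat.lt_succ_self _)]
      simp
    · have he := hD.cond_e (N + 1) (by omega) hlt l hl0 hl1 q hq i
      rw [Nat.add_sub_cancel] at he
      rw [he]
      push_cast
      ring
  · rw [h.mid N p hl0 (by omega), h.mid (N + 1) (p + 1) (by omega) (by omega), h.contr_top hN hq]
    cases N with
    | zero =>
      rw [contr_topCoeff_zero, hD.cond_c hl0 q hq]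
      push_cast
      ring
    | succ N =>
      rw [contr_topCoeff_succ]
      rcases hN.eq_or_lt with rfl | hlt
      · have ha := hD.cond_a hl0 (by omega) q hq i
        rw [Nat.add_sub_cancel] at ha
        rw [ha, hD.L_beyond _ _ (Nat.lt_succ_self _)]
        simp only [Pi.zero_apply]
        push_cast
        field_simp
        ring
      · have hb := hD.cond_b hl0 (N + 2) (by omega) hlt q hq i
        rw [Nat.add_sub_cancel, show N + 2 - 1 = N + 1 from rfl] at hb
        have hN1 : (N : ℝ) + 1 ≠ 0 := by positivity
        have hN2 : ((N + 2 : ℕ) : ℝ) - 1 = (N : ℝ) + 1 := by push_cast; ring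
        rw [hb, hN2]
        push_cast
        field_simp
        ring
  · rw [h.mid N (p + 1) (by omega) le_rfl, h.above N (p + 1 + 2) (by omega), contr_zero]
    rcases hN.eq_or_lt with rfl | hlt
    · rw [h.top_beyond _ (Nat.lt_succ_self _), hD.L_last_killing.2 q hq]
      simp
    · rw [h.top (N + 1) hlt q hq, topCoeff_succ]
      simp only [Pi.zero_apply]
      field_simp
      ring
  · rw [h.above (N + 1) (p + 2 + 1) (by omega), h.above N (p + 2 + 2) (by omega), contr_zero]
    cases N with
    | zero =>
      rw [symCov_congr hU Γ (fun x hx j => (h.top 0 hN x hx j).trans (topCoeff_zero x j)) hq,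
        hD.C_killing.2 q hq]
      simp
    | succ N =>
      have hK := hD.L_killing N (by omega)
      rw [symCov_congr hU Γ (fun x hx j => (h.top (N + 1) hN x hx j).trans (topCoeff_succ N x j)) hq,
        symCov_const_mul Γ _ fun j => hK.1.differentiableAt hU hq j, hK.2 q hq]
      simp

end IsPolyRepr

/-- The coefficients of `t^N` in `I_n^{(m)}`. -/
def polyMembers (Γ : Conn d) (Q : Coord d → Coord d) (n : ℕ) (C : Field d (p + 2))
    (L : ℕ → (r : ℕ) → Field d r) (G : Coord d → ℝ) (N : ℕ) : (r : ℕ) → Field d r :=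
  assemble p (fun q _ => if N = 0 then G q else pairing (L (N - 1) 1) Q q / N) (L N)
    -- The cut-off matters at `N = n + 1`: there `topCoeff` is a multiple of
    -- `L_{(n)(i₁…i_{m-1}|i_m)}`, which is known to vanish only on `U`.
    (if N ≤ n then topCoeff Γ C L N else 0)

theorem isPolyRepr_polyMembers (hL : ∀ N r, n < N → L N r = 0) :
    IsPolyRepr U Γ Q n C L G (polyMembers Γ Q n C L G) where
  mid N r h1 h2 := assemble_mid _ _ _ h1 h2
  top N hN q _ i := by rw [polyMembers, assemble_top, if_pos hN]
  top_beyond N hN := by rw [polyMembers, assemble_top, if_neg (by omega)]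
  base q _ i := by simp [polyMembers, assemble_zero]
  base_succ N hN q _ i := by simp [polyMembers, assemble_zero]
  above N r hr := assemble_above _ _ _ hr
  beyond N hN := by
    funext r q i
    rcases Nat.eq_zero_or_pos r with rfl | h1
    · rw [polyMembers, assemble_zero, if_neg (by omega), hL (N - 1) 1 (by omega)]
      simp [pairing]
    rcases le_or_gt r (p + 1) with h2 | h2
    · rw [polyMembers, assemble_mid _ _ _ h1 h2, hL N r (by omega)]
      rfl
    rcases (show p + 2 ≤ r from h2).eq_or_lt with rfl | h3
    · rw [polyMembers, assemble_top, if_neg (by omega)]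
      rfl
    · rw [polyMembers, assemble_above _ _ _ h3]
      rfl
  L_beyond := hL

theorem IsPolyData.isTensorFamily (hD : IsPolyData U Γ Q n C L s G)
    (hQ : ContDiffOn ℝ (⊤ : ℕ∞) Q U) (N : ℕ) :
    IsTensorFamily U (p + 2) (polyMembers Γ Q n C L G N) := by
  have hL : ∀ N r, 1 ≤ r → r ≤ p + 1 → IsSymmTensor U (L N r) := fun N r h1 h2 => by
    rcases le_or_gt N n with hN | hN
    · exact hD.L_symm N r hN h1 h2
    · rw [hD.L_beyond N r hN]
      exact isSymmTensor_zero U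
  refine isTensorFamily_assemble _ _ _ (isSymmTensor_rank_zero fun _ => ?_) (hL N) ?_
  · split_ifs
    · exact hD.G_smooth
    · exact (contDiffOn_pairing (hL _ 1 le_rfl (by omega)) hQ).div_const _
  · split_ifs with hN
    · cases N with
      | zero => exact hD.C_killing.1.congr fun q _ i => topCoeff_zero q i
      | succ N =>
        exact ((hD.L_killing N (by omega)).1.const_mul _).congr fun q _ i => topCoeff_succ N q i
    · exact isSymmTensor_zero U

theorem isFirstIntegral_integralPoly (hU : IsOpen U) (hQ : ContDiffOn ℝ (⊤ : ℕ∞) Q U)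
    (hD : IsPolyData U Γ Q n C L s G) : IsFirstIntegral U Γ Q (integralPoly Γ Q n C L s G) := by
  have hrep := isPolyRepr_polyMembers (U := U) (Γ := Γ) (Q := Q) (C := C) (G := G) hD.L_beyond
  refine (isFirstIntegral_polyExpFamily (k := n + 2) (S := ∅) (B := 0) hU
    (fun N _ => hD.isTensorFamily hQ N) (by simp) (hrep.beyond _ (by omega))
    (fun N hN r hr q hq i => hrep.det_eq_zero hU hD hN hr hq i) (by simp)).congr
    fun t q hq v => Eq.trans ?_ (hrep.sum_eq hD.s_eq t hq v)
  unfold coeffSum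
  refine Finset.sum_congr rfl fun r _ => congrArg (evalVel · v) (funext fun i => ?_)
  simp only [polyExpFamily, Finset.sum_empty, add_zero]

/-- A polynomial family of tensors that satisfies the determining equations is the family of
coefficients of an integral of polynomial type. -/
theorem exists_isPolyData_of_det_eq_zero (hU : IsOpen U) (hUc : IsPreconnected U)
    (hQ : ContDiffOn ℝ (⊤ : ℕ∞) Q U)
    (hA : ∀ N < n + 2, IsTensorFamily U (p + 2) (A N))
    (hA_beyond : ∀ N r, n < N → 1 ≤ r → A N r = 0) (hA_zero : ∀ N, n + 1 < N → A N = 0)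
    (h : ∀ q ∈ U, ∀ r < p + 4, ∀ i : Fin r → Fin d, ∀ N < n + 2,
      ((N : ℝ) + 1) * A (N + 1) r q i + detCoeff Γ Q (A N) r q i = 0) :
    ∃ (C : Field d (p + 2)) (L : ℕ → (r : ℕ) → Field d r) (s : ℝ) (G : Coord d → ℝ),
      IsPolyData U Γ Q n C L s G ∧ IsPolyRepr U Γ Q n C L G A := by
  -- Truncation is needed since `A (n + 1)` may still have a scalar part, while `L` must vanish
  -- beyond `n` in every rank.
  let L : ℕ → (r : ℕ) → Field d r := fun N => if N ≤ n then A N else 0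
  have hL : ∀ N ≤ n, L N = A N := fun N hN => if_pos hN
  have hL0 : ∀ N r, n < N → L N r = 0 := fun N r hN => by
    simp only [L]
    rw [if_neg (by omega)]
    rfl
  have htop : ∀ N ≤ n, ∀ q ∈ U, ∀ i,
      symCov Γ (L N (p + 1)) q i = -((N : ℝ) + 1) * A (N + 1) (p + 2) q i := by
    intro N hN q hq i
    have := h q hq (p + 2) (by omega) i N (by omega)
    rw [detCoeff_succ, (hA N (by omega)).eq_zero (p + 1 + 2) (by omega), contr_zero] at this
    simp only [Pi.zero_apply] at this
    rw [hL N hN]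
    linear_combination this
  have hrep : IsPolyRepr U Γ Q n (A 0 (p + 2)) L (fun q => A 0 0 q Fin.elim0) A :=
    { mid := fun N r h1 h2 => by
        rcases le_or_gt N n with hN | hN
        · rw [hL N hN]
        · rw [hL0 N r hN, hA_beyond N r hN h1]
      top := fun N hN q hq i => by
        cases N with
        | zero => rw [topCoeff_zero]
        | succ N =>
          rw [topCoeff_succ, htop N (by omega) q hq]
          field_simp
      top_beyond := fun N hN => hA_beyond N _ hN (by omega)
      base := fun q hq i => by rw [Subsingleton.elim i Fin.elim0]
      base_succ := fun N hN q hq i => by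
        have := h q hq 0 (by omega) i N (by omega)
        rw [detCoeff_zero, contr_rank_one] at this
        rw [hL N hN]
        field_simp
        linear_combination this
      above := fun N r hr => by
        rcases lt_or_ge N (n + 2) with hN | hN
        · exact (hA N hN).eq_zero r hr
        · rw [hA_zero N (by omega)]
          rfl
      beyond := hA_zero
      L_beyond := hL0 }
  have hpair : ∀ N ≤ n, ContDiffOn ℝ (⊤ : ℕ∞) (pairing (L N 1) Q) U := fun N hN => by
    rw [hL N hN]
    exact contDiffOn_pairing ((hA N (by omega)).symm 1) hQ
  -- The rank `1` equation at `t^{n+1}` says that this function has zero gradient; `U` is connected.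
  obtain ⟨s, hs⟩ : ∃ s, ∀ q ∈ U, pairing (L n 1) Q q = s := by
    refine exists_eq_const_of_pderiv_eq_zero hU hUc (fun q hq =>
      ((hpair n le_rfl).contDiffAt (hU.mem_nhds hq)).differentiableAt (by simp)) fun q hq k => ?_
    have := h q hq 1 (by omega) (fun _ => k) (n + 1) (by omega)
    rw [detCoeff_succ, hA_beyond (n + 1) (0 + 2) (by omega) (by omega), hA_zero (n + 1 + 1) (by omega),
      contr_zero, hrep.symCov_base_succ hU le_rfl hq] at this
    simp only [Pi.zero_apply, mul_zero, zero_add, sub_zero] at this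
    exact (div_eq_zero_iff.1 this).resolve_right (by positivity)
  have hdiff : ∀ N < n + 2, ∀ r, ∀ q ∈ U, ∀ j, DifferentiableAt ℝ (fun y => A N r y j) q :=
    fun N hN r q hq j => ((hA N hN).symm r).differentiableAt hU hq j
  have hkill : ∀ N < n + 2, ∀ q ∈ U, ∀ i, symCov Γ (A N (p + 2)) q i = 0 := by
    intro N hN q hq i
    have := h q hq (p + 3) (by omega) i N hN
    rw [detCoeff_succ, hrep.above (N + 1) (p + 2 + 1) (by omega),
      hrep.above N (p + 2 + 2) (by omega), contr_zero] at this
    simpa using this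
  refine ⟨A 0 (p + 2), L, s, fun q => A 0 0 q Fin.elim0, ?_, hrep⟩
  refine
    { L_beyond := hL0
      L_symm := fun N r hN _ _ => by
        rw [hL N hN]
        exact (hA N (by omega)).symm r
      G_smooth := contDiffOn_pi.1 ((hA 0 (by omega)).symm 0).1 _
      C_killing := ⟨(hA 0 (by omega)).symm _, hkill 0 (by omega)⟩
      L_killing := fun N hN => ⟨(((hA (N + 1) (by omega)).symm (p + 2)).const_mul _).congr
        (htop N hN.le), fun q hq i => ?_⟩
      L_last_killing := ⟨?_, fun q hq i => ?_⟩
      s_eq := hs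
      cond_a := fun hp hn q hq i => ?_
      cond_b := fun hp k hk hkn q hq i => ?_
      cond_c := fun hp q hq i => ?_
      cond_d := fun l hl hlp q hq i => ?_
      cond_e := fun k hk hkn l hl hlp q hq i => ?_
      cond_g := fun hn q hq a => ?_
      cond_h := fun k hk hkn q hq a => ?_
      cond_i := fun q hq a => ?_ }
  · rw [symCov_congr hU Γ (htop N hN.le) hq,
      symCov_const_mul Γ _ (hdiff (N + 1) (by omega) _ q hq), hkill (N + 1) (by omega) q hq,
      mul_zero]
  · rw [hL n le_rfl]
    exact (hA n (by omega)).symm _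
  · rw [htop n le_rfl q hq, hA_beyond (n + 1) _ (by omega) (by omega)]
    simp
  · obtain ⟨N, rfl⟩ := Nat.exists_eq_add_of_le' hn
    have := h q hq (p + 1) (by omega) i (N + 1) (by omega)
    rw [detCoeff_succ, hrep.contr_top le_rfl hq, contr_topCoeff_succ,
      hA_beyond _ _ (Nat.lt_succ_self _) (by omega)] at this
    rw [hL _ le_rfl, Nat.add_sub_cancel]
    simp only [Pi.zero_apply] at this
    push_cast
    rw [← sub_eq_zero, ← this]
    field_simp
    ring
  · obtain ⟨N, rfl⟩ := Nat.exists_eq_add_of_le' hk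
    have := h q hq (p + 1) (by omega) i (N + 1) (by omega)
    rw [detCoeff_succ, hrep.contr_top (by omega) hq, contr_topCoeff_succ] at this
    rw [hL (N + 2) hkn, Nat.add_sub_cancel, show N + 2 - 1 = N + 1 from rfl, hL (N + 1) (by omega)]
    have hN2 : ((N + 2 : ℕ) : ℝ) - 1 = (N : ℝ) + 1 := by push_cast; ring
    rw [hN2, ← sub_eq_zero, ← this]
    push_cast
    field_simp
    ring
  · have := h q hq (p + 1) (by omega) i 0 (by omega)
    rw [detCoeff_succ, hrep.contr_top (by omega) hq, contr_topCoeff_zero,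
      hrep.mid _ _ (by omega) le_rfl] at this
    rw [hL 0 (by omega)]
    push_cast at this
    linear_combination this
  · have := h q hq (l + 1) (by omega) i n (by omega)
    rw [detCoeff_succ, hA_beyond _ _ (Nat.lt_succ_self _) (by omega)] at this
    rw [hL n le_rfl]
    simp only [Pi.zero_apply] at this
    linear_combination this
  · obtain ⟨N, rfl⟩ := Nat.exists_eq_add_of_le' hk
    have := h q hq (l + 1) (by omega) i N (by omega)
    rw [detCoeff_succ] at this
    rw [hL (N + 1) hkn, Nat.add_sub_cancel, hL N (by omega)]
    push_cast
    linear_combination this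
  · obtain ⟨N, rfl⟩ := Nat.exists_eq_add_of_le' hn
    have := h q hq 1 (by omega) (fun _ => a) (N + 1) (by omega)
    rw [detCoeff_succ, hrep.contr_rank_two le_rfl hq, hrep.symCov_base_succ hU (by omega) hq,
      hA_beyond _ _ (Nat.lt_succ_self _) (by omega)] at this
    rw [Nat.add_sub_cancel]
    simp only [Pi.zero_apply] at this
    field_simp at this
    push_cast at this ⊢
    linear_combination this
  · obtain ⟨N, rfl⟩ := Nat.exists_eq_add_of_le' hk
    have := h q hq 1 (by omega) (fun _ => a) (N + 1) (by omega)
    rw [detCoeff_succ, hrep.contr_rank_two (by omega) hq, hrep.symCov_base_succ hU (by omega) hq,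
      hrep.mid _ _ le_rfl (by omega)] at this
    rw [Nat.add_sub_cancel, show N + 2 - 1 = N + 1 from rfl]
    field_simp at this
    push_cast at this ⊢
    linear_combination this
  · have := h q hq 1 (by omega) (fun _ => a) 0 (by omega)
    rw [detCoeff_succ, hrep.contr_rank_two (by omega) hq, hrep.symCov_base hU hq,
      hrep.mid _ _ le_rfl (by omega)] at this
    push_cast at this
    linear_combination this

end

/-! ### Integrals with mixed coefficients. -/

section

variable {d p n : ℕ} {U : Set (Coord d)} {Γ : Conn d} {Q : Coord d → Coord d}

theorem velPoly_eq_coeffSum {m : ℕ} {M₀ : ℝ → Coord d → ℝ} {M F : (r : ℕ) → ℝ → Field d r} {t : ℝ}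
    {q : Coord d} (h0 : ∀ i, F 0 t q i = M₀ t q)
    (h : ∀ r, 1 ≤ r → r ≤ m → ∀ i, F r t q i = M r t q i) (v : Coord d) :
    velPoly m M₀ M t q v = coeffSum m F t q v := by
  rw [velPoly, coeffSum, Finset.sum_range_succ', sum_Icc_one, evalVel_rank_zero _ _ Fin.elim0, h0,
    add_comm]
  congr 1
  refine Finset.sum_congr rfl fun r hr => ?_
  rw [show F (r + 1) t q = M (r + 1) t q from
    funext (h (r + 1) (by omega) (Finset.mem_range.1 hr))]

/-- The family `M` with its member of rank `0` replaced by `M₀`. -/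
def withBase (M₀ : ℝ → Coord d → ℝ) (M : (r : ℕ) → ℝ → Field d r) : (r : ℕ) → ℝ → Field d r
  | 0 => fun t q _ => M₀ t q
  | r + 1 => M (r + 1)

theorem IsCoeffFamily.withBase {m : ℕ} {M : (r : ℕ) → ℝ → Field d r} (hM : IsCoeffFamily U m M)
    (hU : IsOpen U) {M₀ : ℝ → Coord d → ℝ}
    (hM₀ : ContDiffOn ℝ (⊤ : ℕ∞) (fun x : ℝ × Coord d => M₀ x.1 x.2) (Set.univ ×ˢ U)) :
    IsCoeffFamily U m (withBase M₀ M) where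
  diff r i t q hq := by
    cases r with
    | zero =>
      exact (hM₀.contDiffAt ((isOpen_univ.prod hU).mem_nhds ⟨mem_univ t, hq⟩)).differentiableAt
        (by simp)
    | succ r => exact hM.diff (r + 1) i t q hq
  symm r t q hq σ i := by
    cases r with
    | zero => rfl
    | succ r => exact hM.symm (r + 1) t q hq σ i
  eq_zero r hr := by
    cases r with
    | zero => omega
    | succ r => exact hM.eq_zero (r + 1) hr

theorem IsCoeffFamily.differentiable_time {m : ℕ} {M : (r : ℕ) → ℝ → Field d r}
    (hM : IsCoeffFamily U m M) {q : Coord d} (hq : q ∈ U) (r : ℕ) (i : Fin r → Fin d) :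
    Differentiable ℝ fun t => M r t q i := fun t =>
  DifferentiableAt.comp (g := fun x : ℝ × Coord d => M r x.1 x.2 i) (f := fun t => (t, q)) t
    (hM.diff r i t q hq) (differentiableAt_id.prodMk (differentiableAt_const q))

/-- The coefficients of `t^N` in a first integral with polynomial and exponential coefficients. -/
def mixedPolyMembers (p : ℕ) (Q : Coord d → Coord d) (n : ℕ) (A : ℕ → (r : ℕ) → Field d r)
    (S : Finset ℝ) (B : ℝ → (r : ℕ) → Field d r) (G : Coord d → ℝ) (N : ℕ) :
    (r : ℕ) → Field d r :=
  assemble p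
    -- The scalar part is the antiderivative in `t` of `M_c Q^c`; the subtracted sum cancels the
    -- exponential terms at `t = 0`, so that its value there is `G`.
    (fun q _ => if N = 0 then G q - ∑ lam ∈ S, pairing (B lam 1) Q q / lam
      else if N ≤ n + 1 then pairing (A (N - 1) 1) Q q / N else 0)
    (if N ≤ n then A N else 0) (if N ≤ n then A N (p + 2) else 0)

/-- The coefficients of `e^{λt}` in a first integral with polynomial and exponential
coefficients. -/
def mixedExpMembers (p : ℕ) (Q : Coord d → Coord d) (B : ℝ → (r : ℕ) → Field d r) (lam : ℝ) :
    (r : ℕ) → Field d r :=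
  assemble p (fun q _ => pairing (B lam 1) Q q / lam) (B lam) (B lam (p + 2))

variable {A : ℕ → (r : ℕ) → Field d r} {S : Finset ℝ} {B : ℝ → (r : ℕ) → Field d r}
  {G : Coord d → ℝ}

theorem mixedPolyMembers_eq {N r : ℕ} (hN : N ≤ n) (h1 : 1 ≤ r) (h2 : r ≤ p + 2) :
    mixedPolyMembers p Q n A S B G N r = A N r := by
  rcases (show r ≤ p + 1 ∨ r = p + 2 by omega) with h | rfl
  · rw [mixedPolyMembers, assemble_mid _ _ _ h1 h, if_pos hN]
  · rw [mixedPolyMembers, assemble_top, if_pos hN]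

theorem mixedPolyMembers_beyond {N r : ℕ} (hN : n < N) (h1 : 1 ≤ r) :
    mixedPolyMembers p Q n A S B G N r = 0 := by
  rcases (show r ≤ p + 1 ∨ r = p + 2 ∨ p + 2 < r by omega) with h | rfl | h
  · rw [mixedPolyMembers, assemble_mid _ _ _ h1 h, if_neg (by omega)]
    rfl
  · rw [mixedPolyMembers, assemble_top, if_neg (by omega)]
  · exact assemble_above _ _ _ h

theorem mixedPolyMembers_zero {N : ℕ} (hN : n + 1 < N) :
    mixedPolyMembers p Q n A S B G N = 0 := by
  funext r
  rcases Nat.eq_zero_or_pos r with rfl | h1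
  · funext q i
    rw [mixedPolyMembers, assemble_zero, if_neg (by omega), if_neg (by omega)]
    rfl
  · exact mixedPolyMembers_beyond (by omega) h1

theorem mixedPolyMembers_base_succ {N : ℕ} (hN : N ≤ n) (q : Coord d) (i : Fin 0 → Fin d) :
    mixedPolyMembers p Q n A S B G (N + 1) 0 q i = pairing (A N 1) Q q / ((N : ℝ) + 1) := by
  rw [mixedPolyMembers, assemble_zero, if_neg (by omega), if_pos (by omega)]
  push_cast
  rfl

theorem mixedExpMembers_eq {lam : ℝ} {r : ℕ} (h1 : 1 ≤ r) (h2 : r ≤ p + 2) :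
    mixedExpMembers p Q B lam r = B lam r := by
  rcases (show r ≤ p + 1 ∨ r = p + 2 by omega) with h | rfl
  · exact assemble_mid _ _ _ h1 h
  · exact assemble_top _ _ _

theorem isTensorFamily_mixedExpMembers (hQ : ContDiffOn ℝ (⊤ : ℕ∞) Q U) {lam : ℝ}
    (hB : ∀ r, 1 ≤ r → r ≤ p + 2 → IsSymmTensor U (B lam r)) :
    IsTensorFamily U (p + 2) (mixedExpMembers p Q B lam) :=
  isTensorFamily_assemble _ _ _
    (isSymmTensor_rank_zero fun _ =>
      (contDiffOn_pairing (hB 1 le_rfl (by omega)) hQ).div_const lam)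
    (fun r h1 h2 => hB r h1 (by omega)) (hB _ (by omega) le_rfl)

theorem isTensorFamily_mixedPolyMembers (hQ : ContDiffOn ℝ (⊤ : ℕ∞) Q U)
    (hA : ∀ N r, N ≤ n → 1 ≤ r → r ≤ p + 2 → IsSymmTensor U (A N r))
    (hB : ∀ lam ∈ S, ∀ r, 1 ≤ r → r ≤ p + 2 → IsSymmTensor U (B lam r))
    (hG : ContDiffOn ℝ (⊤ : ℕ∞) G U) (N : ℕ) :
    IsTensorFamily U (p + 2) (mixedPolyMembers p Q n A S B G N) := by
  refine isTensorFamily_assemble _ _ _ (isSymmTensor_rank_zero fun _ => ?_)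
    (fun r h1 h2 => ?_) ?_
  · split_ifs with h1 h2
    · exact hG.sub (ContDiffOn.sum fun lam hlam =>
        (contDiffOn_pairing (hB lam hlam 1 le_rfl (by omega)) hQ).div_const lam)
    · exact (contDiffOn_pairing (hA (N - 1) 1 (by omega) le_rfl (by omega)) hQ).div_const _
    · exact contDiffOn_const
  · split_ifs with hN
    · exact hA N r hN h1 (by omega)
    · exact isSymmTensor_zero U
  · split_ifs with hN
    · exact hA N _ hN (by omega) le_rfl
    · exact isSymmTensor_zero U

theorem polyExpFamily_mixed {r : ℕ} (h1 : 1 ≤ r) (h2 : r ≤ p + 2) (t : ℝ) (q : Coord d)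
    (i : Fin r → Fin d) :
    polyExpFamily (n + 2) (mixedPolyMembers p Q n A S B G) S (mixedExpMembers p Q B) r t q i
      = ∑ N ∈ Finset.range (n + 1), t ^ N * A N r q i
        + ∑ lam ∈ S, Real.exp (lam * t) * B lam r q i := by
  unfold polyExpFamily
  rw [Finset.sum_range_succ, mixedPolyMembers_beyond (Nat.lt_succ_self n) h1]
  simp only [Pi.zero_apply, mul_zero, add_zero, mixedExpMembers_eq h1 h2]
  congr 1
  exact Finset.sum_congr rfl fun N hN => by
    rw [mixedPolyMembers_eq (Nat.lt_succ_iff.1 (Finset.mem_range.1 hN)) h1 h2]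

theorem mixed_det_rank_zero {N : ℕ} (hN : N < n + 2) (q : Coord d) (i : Fin 0 → Fin d) :
    ((N : ℝ) + 1) * mixedPolyMembers p Q n A S B G (N + 1) 0 q i
      + detCoeff Γ Q (mixedPolyMembers p Q n A S B G N) 0 q i = 0 := by
  rw [detCoeff_zero]
  obtain rfl | hN : N = n + 1 ∨ N ≤ n := by omega
  · rw [mixedPolyMembers_zero (by omega), mixedPolyMembers_beyond (Nat.lt_succ_self n) le_rfl,
      contr_zero]
    simp
  · rw [mixedPolyMembers_base_succ hN, mixedPolyMembers_eq hN le_rfl (by omega), contr_rank_one]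
    field_simp
    ring

theorem mixed_det_exp_rank_zero {lam : ℝ} (hlam : lam ≠ 0) (q : Coord d) (i : Fin 0 → Fin d) :
    lam * mixedExpMembers p Q B lam 0 q i + detCoeff Γ Q (mixedExpMembers p Q B lam) 0 q i = 0 := by
  rw [detCoeff_zero, mixedExpMembers_eq le_rfl (by omega), contr_rank_one, mixedExpMembers,
    assemble_zero]
  field_simp
  ring

/-- The rank `0` coefficient of a first integral is determined by the rank `1` coefficient and by
its value at `t = 0`. -/
theorem base_eq_of_isFirstIntegral (hU : IsOpen U) (hΓ : ContDiffOn ℝ (⊤ : ℕ∞) Γ U)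
    (hQ : ContDiffOn ℝ (⊤ : ℕ∞) Q U) {M₀ : ℝ → Coord d → ℝ} (h0 : 0 ∉ S)
    (hA : ∀ N r, N ≤ n → 1 ≤ r → r ≤ p + 2 → IsSymmTensor U (A N r))
    (hB : ∀ lam ∈ S, ∀ r, 1 ≤ r → r ≤ p + 2 → IsSymmTensor U (B lam r))
    (hM₀ : ContDiffOn ℝ (⊤ : ℕ∞) (fun x : ℝ × Coord d => M₀ x.1 x.2) (Set.univ ×ˢ U))
    (hG : ContDiffOn ℝ (⊤ : ℕ∞) (M₀ 0) U)
    (hI : IsFirstIntegral U Γ Q (velPoly (p + 2) M₀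
      (fun r t q i => ∑ N ∈ Finset.range (n + 1), t ^ N * A N r q i
        + ∑ lam ∈ S, Real.exp (lam * t) * B lam r q i)))
    (t : ℝ) {q : Coord d} (hq : q ∈ U) (i : Fin 0 → Fin d) :
    polyExpFamily (n + 2) (mixedPolyMembers p Q n A S B (M₀ 0)) S (mixedExpMembers p Q B) 0 t q i
      = M₀ t q := by
  have hA' := fun N (_ : N < n + 2) => isTensorFamily_mixedPolyMembers hQ hA hB hG N
  have hB' := fun lam hlam => isTensorFamily_mixedExpMembers hQ (hB lam hlam)
  have hF := isCoeffFamily_polyExpFamily hU hA' hB'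
  set F := polyExpFamily (n + 2) (mixedPolyMembers p Q n A S B (M₀ 0)) S (mixedExpMembers p Q B)
    with hFdef
  have hW := hF.withBase hU hM₀
  have hIW : IsFirstIntegral U Γ Q (coeffSum (p + 2) (withBase M₀ F)) :=
    hI.congr fun t q _ v => velPoly_eq_coeffSum (fun _ => rfl) (fun r h1 h2 i => by
      obtain ⟨r, rfl⟩ := Nat.exists_eq_add_of_le' h1
      exact polyExpFamily_mixed h1 h2 t q i) v
  -- `F 0` and `M₀` both solve `∂_t M = M_c Q^c` with the same covector `M_c`, so their difference
  -- does not depend on `t`; at `t = 0` it vanishes.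
  have hder : ∀ τ, deriv (fun t => F 0 t q i - withBase M₀ F 0 t q i) τ = 0 := by
    intro τ
    have h1 := timeDeriv_add_detCoeff_eq_zero hU hΓ hQ hW hIW τ hq (r := 0) (by omega) i
    have h2 := polyExpFamily_det_eq hU Γ Q hA' hB' (mixedPolyMembers_zero (by omega)) τ hq 0 i
    rw [Finset.sum_eq_zero fun N hN => by
        rw [mixed_det_rank_zero (Finset.mem_range.1 hN), mul_zero],
      Finset.sum_eq_zero fun lam hlam => by
        rw [mixed_det_exp_rank_zero (fun e => h0 (e ▸ hlam)), mul_zero], add_zero] at h2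
    rw [deriv_fun_sub (hF.differentiable_time hq 0 i τ) (hW.differentiable_time hq 0 i τ)]
    exact sub_eq_zero.2 (add_right_cancel (h2.trans h1.symm))
  have hconst := is_const_of_deriv_eq_zero
    ((hF.differentiable_time hq 0 i).sub (hW.differentiable_time hq 0 i)) hder t 0
  have hF0 : F 0 0 q i = M₀ 0 q := by
    rw [hFdef]
    unfold polyExpFamily
    rw [Finset.sum_range_succ']
    simp [mixedPolyMembers, mixedExpMembers, assemble_zero]
  have : F 0 t q i - M₀ t q = F 0 0 q i - M₀ 0 q := hconst
  rw [hF0, sub_self] at this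
  exact sub_eq_zero.1 this

/-- Once `M₀` is known to combine powers and exponentials too, independence separates the equations
of the polynomial part from those of each exponential, and each part is identified with its type. -/
theorem exists_data_of_isFirstIntegral (hU : IsOpen U) (hUc : IsPreconnected U)
    (hΓ : ContDiffOn ℝ (⊤ : ℕ∞) Γ U) (hQ : ContDiffOn ℝ (⊤ : ℕ∞) Q U) {M₀ : ℝ → Coord d → ℝ}
    (h0 : 0 ∉ S)
    (hA : ∀ N r, N ≤ n → 1 ≤ r → r ≤ p + 2 → IsSymmTensor U (A N r))
    (hB : ∀ lam ∈ S, ∀ r, 1 ≤ r → r ≤ p + 2 → IsSymmTensor U (B lam r))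
    (hM₀ : ContDiffOn ℝ (⊤ : ℕ∞) (fun x : ℝ × Coord d => M₀ x.1 x.2) (Set.univ ×ˢ U))
    (hI : IsFirstIntegral U Γ Q (velPoly (p + 2) M₀
      (fun r t q i => ∑ N ∈ Finset.range (n + 1), t ^ N * A N r q i
        + ∑ lam ∈ S, Real.exp (lam * t) * B lam r q i))) :
    ∃ (C : Field d (p + 2)) (L : ℕ → (r : ℕ) → Field d r) (s : ℝ) (G : Coord d → ℝ)
      (K : ℝ → (r : ℕ) → Field d r),
      IsPolyData U Γ Q n C L s G ∧ (∀ lam ∈ S, IsExpData p U Γ Q lam (K lam)) ∧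
      ∀ t, ∀ q ∈ U, ∀ v,
        velPoly (p + 2) M₀
            (fun r t q i => ∑ N ∈ Finset.range (n + 1), t ^ N * A N r q i
              + ∑ lam ∈ S, Real.exp (lam * t) * B lam r q i) t q v
          = integralPoly Γ Q n C L s G t q v
            + ∑ lam ∈ S, integralExp p Γ Q lam (K lam) t q v := by
  have hG : ContDiffOn ℝ (⊤ : ℕ∞) (M₀ 0) U :=
    hM₀.comp (f := fun q : Coord d => ((0 : ℝ), q)) (contDiffOn_const.prodMk contDiffOn_id)
      fun q hq => ⟨mem_univ _, hq⟩
  have hA' := fun N (_ : N < n + 2) => isTensorFamily_mixedPolyMembers hQ hA hB hG N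
  have hB' := fun lam hlam => isTensorFamily_mixedExpMembers hQ (hB lam hlam)
  have hval : ∀ t, ∀ q ∈ U, ∀ v, velPoly (p + 2) M₀
      (fun r t q i => ∑ N ∈ Finset.range (n + 1), t ^ N * A N r q i
        + ∑ lam ∈ S, Real.exp (lam * t) * B lam r q i) t q v
      = coeffSum (p + 2) (polyExpFamily (n + 2) (mixedPolyMembers p Q n A S B (M₀ 0)) S
        (mixedExpMembers p Q B)) t q v := fun t q hq v =>
    velPoly_eq_coeffSum (base_eq_of_isFirstIntegral hU hΓ hQ h0 hA hB hM₀ hG hI t hq)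
      (fun r h1 h2 i => polyExpFamily_mixed h1 h2 t q i) v
  have hdet := fun {q : Coord d} (hq : q ∈ U) {r : ℕ} (hr : r < p + 4) i =>
    det_eq_zero_of_isFirstIntegral hU hΓ hQ h0 hA' hB' (mixedPolyMembers_zero (by omega))
      (hI.congr hval) hq hr i
  obtain ⟨C, L, s, G, hD, hrep⟩ := exists_isPolyData_of_det_eq_zero (Γ := Γ) hU hUc hQ hA'
    (fun N r hN hr => mixedPolyMembers_beyond hN hr) (fun N hN => mixedPolyMembers_zero hN)
    fun q hq r hr i => (hdet hq hr i).1
  have hlam : ∀ lam ∈ S, lam ≠ 0 := fun lam hS e => h0 (e ▸ hS)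
  refine ⟨C, L, s, G, mixedExpMembers p Q B, hD, fun lam hS =>
    isExpData_of_det_eq_zero hU (hlam lam hS) (hB' lam hS) fun q hq r hr i =>
      (hdet hq hr i).2 lam hS, fun t q hq v => ?_⟩
  rw [hval t q hq v, ← hrep.sum_eq hD.s_eq t hq v,
    Finset.sum_congr rfl fun lam hS => ((isExpRepr_of_det_eq_zero (Γ := Γ) (hlam lam hS)
      (hB' lam hS) fun q hq r hr i => (hdet hq hr i).2 lam hS).sum_eq (hlam lam hS) t hq v).symm,
    Finset.sum_comm, ← Finset.sum_add_distrib, coeffSum]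
  refine Finset.sum_congr rfl fun r _ => ?_
  rw [← evalVel_sum, ← evalVel_add]
  rfl

theorem exists_isExpData_of_isFirstIntegral (hU : IsOpen U)
    (hΓ : ContDiffOn ℝ (⊤ : ℕ∞) Γ U) (hQ : ContDiffOn ℝ (⊤ : ℕ∞) Q U) {lam : ℝ} (hlam : lam ≠ 0)
    {B₀ : Coord d → ℝ} {B : (r : ℕ) → Field d r} (hB₀ : ContDiffOn ℝ (⊤ : ℕ∞) B₀ U)
    (hB : ∀ r, 1 ≤ r → r ≤ p + 2 → IsSymmTensor U (B r))
    (hI : IsFirstIntegral U Γ Q (velPoly (p + 2) (fun t q => Real.exp (lam * t) * B₀ q)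
        (fun r t q i => Real.exp (lam * t) * B r q i))) :
    ∃ L : (r : ℕ) → Field d r, IsExpData p U Γ Q lam L ∧
      ∀ t, ∀ q ∈ U, ∀ v,
        velPoly (p + 2) (fun t q => Real.exp (lam * t) * B₀ q)
            (fun r t q i => Real.exp (lam * t) * B r q i) t q v
          = integralExp p Γ Q lam L t q v := by
  -- The scalar coefficient is already `e^{λt}` times a function of `q`, so no integration in `t` is
  -- needed.
  let K := assemble p (fun q _ => B₀ q) B (B (p + 2))
  have hK : IsTensorFamily U (p + 2) K := isTensorFamily_assemble _ _ _
    (isSymmTensor_rank_zero fun _ => hB₀) (fun r h1 h2 => hB r h1 (by omega))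
    (hB _ (by omega) le_rfl)
  have hF : ∀ r t q i, polyExpFamily 0 0 {lam} (fun _ => K) r t q i
      = Real.exp (lam * t) * K r q i := fun r t q i => by
    simp only [polyExpFamily, Finset.range_zero, Finset.sum_empty, zero_add, Finset.sum_singleton]
  have hval : ∀ t, ∀ q ∈ U, ∀ v, velPoly (p + 2) (fun t q => Real.exp (lam * t) * B₀ q)
      (fun r t q i => Real.exp (lam * t) * B r q i) t q v
      = coeffSum (p + 2) (polyExpFamily 0 0 {lam} fun _ => K) t q v := fun t q _ v =>
    velPoly_eq_coeffSum (fun i => hF 0 t q i) (fun r h1 h2 i => by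
      rw [hF]
      rcases (show r ≤ p + 1 ∨ r = p + 2 by omega) with h | rfl
      · rw [show K r = B r from assemble_mid _ _ _ h1 h]
      · rw [show K (p + 2) = B (p + 2) from assemble_top _ _ _]) v
  have hdet : ∀ q ∈ U, ∀ r < p + 4, ∀ i : Fin r → Fin d,
      lam * K r q i + detCoeff Γ Q K r q i = 0 := fun q hq r hr i =>
    (det_eq_zero_of_isFirstIntegral hU hΓ hQ (S := {lam}) (by simpa using hlam.symm) (by simp)
      (fun _ _ => hK) rfl (hI.congr hval) hq hr i).2 lam (Finset.mem_singleton_self lam)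
  refine ⟨K, isExpData_of_det_eq_zero hU hlam hK hdet, fun t q hq v => ?_⟩
  rw [hval t q hq v, ← (isExpRepr_of_det_eq_zero hlam hK hdet).sum_eq hlam t hq v, coeffSum]
  exact Finset.sum_congr rfl fun r _ => congrArg (evalVel · v) (funext fun i => hF r t q i)

end

end

end FirstIntegrals

/-! ### The theorem. -/

open FirstIntegrals in
theorem theorem1 (d p : ℕ) (U : Set (Coord d)) (hU : IsOpen U) (hUc : IsPreconnected U)
    (Γ : Conn d) (hΓ : ContDiffOn ℝ (⊤ : ℕ∞) Γ U)
    (hΓsymm : ∀ q ∈ U, ∀ a b c, Γ q a b c = Γ q a c b)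
    (Q : Coord d → Coord d) (hQ : ContDiffOn ℝ (⊤ : ℕ∞) Q U) :
    -- every `I_n^{(m)}` (with `m = p + 2`) is a first integral
    (∀ (n : ℕ) (C : Field d (p + 2)) (L : ℕ → (r : ℕ) → Field d r) (s : ℝ) (G : Coord d → ℝ),
      IsPolyData U Γ Q n C L s G →
        IsFirstIntegral U Γ Q (integralPoly Γ Q n C L s G)) ∧
    -- every `I_e^{(m)}` is a first integral
    (∀ (lam : ℝ) (L : (r : ℕ) → Field d r), lam ≠ 0 → IsExpData p U Γ Q lam L →
        IsFirstIntegral U Γ Q (integralExp p Γ Q lam L)) ∧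
    -- a first integral with coefficients of degree at most `n` in `t` is an `I_n^{(m)}`
    (∀ (n : ℕ) (A : ℕ → (r : ℕ) → Field d r) (M₀ : ℝ → Coord d → ℝ),
      (∀ N r, N ≤ n → 1 ≤ r → r ≤ p + 2 → IsSymmTensor U (A N r)) →
      ContDiffOn ℝ (⊤ : ℕ∞) (fun x : ℝ × Coord d => M₀ x.1 x.2) (Set.univ ×ˢ U) →
      IsFirstIntegral U Γ Q (velPoly (p + 2) M₀
        (fun r t q i => ∑ N ∈ Finset.range (n + 1), t ^ N * A N r q i)) →
      ∃ (C : Field d (p + 2)) (L : ℕ → (r : ℕ) → Field d r) (s : ℝ) (G : Coord d → ℝ),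
        IsPolyData U Γ Q n C L s G ∧
        ∀ t, ∀ q ∈ U, ∀ v,
          velPoly (p + 2) M₀ (fun r t q i => ∑ N ∈ Finset.range (n + 1), t ^ N * A N r q i) t q v
            = integralPoly Γ Q n C L s G t q v) ∧
    -- a first integral with coefficients proportional to `e^{λt}` is an `I_e^{(m)}`
    (∀ (lam : ℝ) (B₀ : Coord d → ℝ) (B : (r : ℕ) → Field d r), lam ≠ 0 →
      ContDiffOn ℝ (⊤ : ℕ∞) B₀ U →
      (∀ r, 1 ≤ r → r ≤ p + 2 → IsSymmTensor U (B r)) →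
      IsFirstIntegral U Γ Q (velPoly (p + 2) (fun t q => Real.exp (lam * t) * B₀ q)
        (fun r t q i => Real.exp (lam * t) * B r q i)) →
      ∃ L : (r : ℕ) → Field d r, IsExpData p U Γ Q lam L ∧
        ∀ t, ∀ q ∈ U, ∀ v,
          velPoly (p + 2) (fun t q => Real.exp (lam * t) * B₀ q)
              (fun r t q i => Real.exp (lam * t) * B r q i) t q v
            = integralExp p Γ Q lam L t q v) ∧
    -- a first integral with mixed coefficients is a sum of one `I_n^{(m)}` and of `I_e^{(m)}`s
    (∀ (n : ℕ) (S : Finset ℝ) (A : ℕ → (r : ℕ) → Field d r) (B : ℝ → (r : ℕ) → Field d r)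
      (M₀ : ℝ → Coord d → ℝ), 0 ∉ S →
      (∀ N r, N ≤ n → 1 ≤ r → r ≤ p + 2 → IsSymmTensor U (A N r)) →
      (∀ lam ∈ S, ∀ r, 1 ≤ r → r ≤ p + 2 → IsSymmTensor U (B lam r)) →
      ContDiffOn ℝ (⊤ : ℕ∞) (fun x : ℝ × Coord d => M₀ x.1 x.2) (Set.univ ×ˢ U) →
      IsFirstIntegral U Γ Q (velPoly (p + 2) M₀
        (fun r t q i => ∑ N ∈ Finset.range (n + 1), t ^ N * A N r q i
          + ∑ lam ∈ S, Real.exp (lam * t) * B lam r q i)) →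
      ∃ (C : Field d (p + 2)) (L : ℕ → (r : ℕ) → Field d r) (s : ℝ) (G : Coord d → ℝ)
        (K : ℝ → (r : ℕ) → Field d r),
        IsPolyData U Γ Q n C L s G ∧ (∀ lam ∈ S, IsExpData p U Γ Q lam (K lam)) ∧
        ∀ t, ∀ q ∈ U, ∀ v,
          velPoly (p + 2) M₀
              (fun r t q i => ∑ N ∈ Finset.range (n + 1), t ^ N * A N r q i
                + ∑ lam ∈ S, Real.exp (lam * t) * B lam r q i) t q v
            = integralPoly Γ Q n C L s G t q v
              + ∑ lam ∈ S, integralExp p Γ Q lam (K lam) t q v) := by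
  refine ⟨fun n C L s G hD => isFirstIntegral_integralPoly hU hQ hD,
    fun lam L hlam hL => isFirstIntegral_integralExp hU hQ hlam hL,
    fun n A M₀ hA hM₀ hI => ?_,
    fun lam B₀ B hlam hB₀ hB hI => exists_isExpData_of_isFirstIntegral hU hΓ hQ hlam hB₀ hB hI,
    fun n S A B M₀ h0 hA hB hM₀ hI =>
      exists_data_of_isFirstIntegral hU hUc hΓ hQ h0 hA hB hM₀ hI⟩
  -- The polynomial case is the mixed case without exponents.
  obtain ⟨C, L, s, G, _, hD, -, h⟩ := exists_data_of_isFirstIntegral (S := ∅)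
    (B := fun _ _ => 0) hU hUc hΓ hQ (Finset.notMem_empty 0) hA (by simp) hM₀
    (by simpa only [Finset.sum_empty, add_zero] using hI)
  refine ⟨C, L, s, G, hD, ?_⟩
  simpa only [Finset.sum_empty, add_zero] using h
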